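/- **Setting.** A hypothesis class on $X$ parameterized by $Y\neq\emptyset$ is a function $\mathcal H:X\times Y\to[0,1]$, with hypotheses $h_y=\mathcal H(\cdot,y)$; its dual class is the class on $Y$ parameterized by $X$ given by the same function. $\mathcal H$ $\gamma$-fat-shatters $A\subseteq X$ if there is $s:A\to[0,1]$ such that for every $E\subseteq A$ some $y$ satisfies $h_y\ge s+\gamma$ on $E$ and $h_y\le s-\gamma$ on $A\setminus E$; the $\gamma$ fat-shattering dimension is the supremum of the cardinalities of $\gamma$-fat-shattered sets. A concept class is a $\{0,1\}$-valued class; its VC-dimension is the supremum of the cardinalities of shattered sets. Let $X$ carry a $\sigma$-algebra. For a probability measure $P$ on $Z=X\times[0,1]$ put $\mathrm{ExpLoss}_P(h)=\int (h(x)-t)^2\,dP(x,t)$. $\mathcal H$ is *$\delta,\epsilon$ agnostic PAC learnable with sample complexity $N$* if there is a map $A$ from finite sequences in $Z$ to hypotheses of $\mathcal H$ such that for all $n\ge N$ and all $P$, $$P^n\Big(\mathrm{ExpLoss}_P(A(\vec z))\le \inf_{h\in\mathcal H}\mathrm{ExpLoss}_P(h)+\epsilon\Big)\ge 1-\delta$$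 (if this event is not measurable, it is required that its complement have outer $P^n$-measure at most $\delta$). Given a probability space $(\Omega,\Sigma,\mu)$, a measurable family is a family $\mathcal F=(\mathcal H_\omega)_{\omega\in\Omega}$ of classes on $X$ parameterized by $Y$ with $\omega\mapsto\mathcal H_\omega(x,y)$ measurable for all $x,y$; its expectation class is $\mathbb E\mathcal F(x,y)=\mathbb E_\mu[\mathcal H_\omega(x,y)]$. The distribution class of $\mathcal H$ is the class on $X$ of the functions $h_\nu(x)=\mathbb E_{y\sim\nu}[\mathcal H(x,y)]$, where $\nu$ ranges over the probability measures on $\sigma$-algebras on $Y$ making every $\mathcal H(x,\cdot)$ measurable. The dual distribution class of $\mathcal H$ is the distribution class of its dual class. Call a class *separable* if there is a countable set $D$ of parameters such that each hypothesis is the pointwise limit of a sequence of hypotheses with parameters in $D$ (automatic if the parameter space is countable). Call a class *jointly measurable* if it is measurable on the product of its range space and its parameter space, the latter with the $\sigma$-algebra generated by the functions $\mathcal H(x,\cdot)$ (automatic if the parameter space is countable and each hypothesis is measurable). **Theorem.** For every $\epsilon_0<1$ there is a constant $C>0$, depending only on $\epsilon_0$, such that for all $0<\epsilon\le\epsilon_0$,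 $0<\delta<1$ and $d\in\mathbb N$, with $$N_1=\Big\lceil C\Big(\frac d{\epsilon^4}\log^2\frac d\epsilon+\frac1{\epsilon^2}\log\frac1\delta\Big)\Big\rceil,\qquad N_2=\Big\lceil \frac C{\epsilon^2}\Big(d\log\frac d\epsilon+\log\frac1\delta\Big)\Big\rceil$$ (the terms with factor $d$ being $0$ for $d=0$): 1. Let $\mathcal F$ be a measurable family such that the class $\mathbb E\mathcal F$ is separable and consists of measurable functions. If every $\mathcal H_\omega$ has $\frac\epsilon{50}$ fat-shattering dimension at most $d$, then $\mathbb E\mathcal F$ is $\delta,\epsilon$ agnostic PAC learnable with sample complexity $N_1$. If every $\mathcal H_\omega$ is a concept class of VC-dimension at most $d$, then $\mathbb E\mathcal F$ is so learnable with sample complexity $N_2$. 2. Let $\mathcal H$ be a separable, jointly measurable class. If $\mathcal H$ has $\frac\epsilon{50}$ fat-shattering dimension at most $d$, then its distribution class is $\delta,\epsilon$ agnostic PAC learnable with sample complexity $N_1$; if $\mathcal H$ is a concept class of VC-dimension at most $d$, with sample complexity $N_2$. 3. Let $\mathcal H$ be a class (with $X\ne\emptyset$, and a $\sigma$-algebra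 on $Y$ instead of $X$) whose dual class is separable and jointly measurable. If the dual class has $\frac\epsilon{50}$ fat-shattering dimension at most $d$, then the dual distribution class of $\mathcal H$ is $\delta,\epsilon$ agnostic PAC learnable with sample complexity $N_1$; if $\mathcal H$ is a concept class whose dual has VC-dimension at most $d$, with sample complexity $N_2$. -/

import Mathlib

open MeasureTheory Filter Topology

namespace StatLearning

noncomputable section

/-- A hypothesis class on the range space `X` with parameter space `Y`: the function
`H : X × Y → [0,1]`; its hypotheses are the functions `h_y = fun x => H x y`. -/
abbrev HypClass (X : Type*) (Y : Type*) := X → Y → unitInterval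

/-- The dual class: the roles of range elements and parameters are exchanged. -/
def dualClass {X Y : Type*} (H : HypClass X Y) : HypClass Y X := fun y x => H x y

/-! ## Combinatorial dimensions -/

/-- `H` `γ`-fat-shatters the set `A`. (Only the values of `s` on `A` matter.) -/
def FatShatters {X Y : Type*} (H : HypClass X Y) (γ : ℝ) (A : Set X) : Prop :=
  ∃ s : X → unitInterval, ∀ E ⊆ A, ∃ y : Y,
    (∀ x ∈ A \ E, (H x y : ℝ) ≤ s x - γ) ∧ (∀ x ∈ E, (s x : ℝ) + γ ≤ H x y)

/-- The `γ` fat-shattering dimension: the supremum of the cardinalities of `γ`-fat-shattered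
sets. -/
def fatDim {X Y : Type*} (H : HypClass X Y) (γ : ℝ) : ℕ∞ :=
  ⨆ (A : Set X) (_ : FatShatters H γ A), A.encard

/-- A concept class is a `{0,1}`-valued hypothesis class; the concept with parameter `y` is
`{x | H x y = 1}`. -/
def IsConceptClass {X Y : Type*} (H : HypClass X Y) : Prop :=
  ∀ x y, H x y = 0 ∨ H x y = 1

/-- Some concept contains `E` and is disjoint from `A \ E`, for every `E ⊆ A`. -/
def Shatters {X Y : Type*} (H : HypClass X Y) (A : Set X) : Prop :=
  ∀ E ⊆ A, ∃ y : Y, E ⊆ {x | H x y = 1} ∧ Disjoint {x | H x y = 1} (A \ E)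

/-- The Vapnik-Chervonenkis dimension. -/
def vcDim {X Y : Type*} (H : HypClass X Y) : ℕ∞ :=
  ⨆ (A : Set X) (_ : Shatters H A), A.encard

/-! ## Agnostic PAC learning -/

/-- Samples `(x, y) ∈ Z = X × [0,1]`. -/
abbrev Sample (X : Type*) := X × unitInterval

/-- The squared loss of the hypothesis `h` at a sample. -/
def loss {X : Type*} (h : X → unitInterval) (z : Sample X) : ℝ :=
  ((h z.1 : ℝ) - (z.2 : ℝ)) ^ 2

def expLoss {X : Type*} [MeasurableSpace X] (P : Measure (Sample X)) (h : X → unitInterval) : ℝ :=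
  ∫ z, loss h z ∂P

def bestExpLoss {X Y : Type*} [MeasurableSpace X] (P : Measure (Sample X))
    (H : HypClass X Y) : ℝ :=
  ⨅ y : Y, expLoss P (fun x => H x y)

/-- `H` is agnostic PAC learnable to accuracy `ε` and confidence `δ` with sample complexity `N`:
there is one procedure `A`, mapping finite sequences of samples to hypotheses of `H`
(given by their parameters), such that for all `n ≥ N` and every distribution `P` on `X × [0,1]`,
with `P^n`-probability at least `1 - δ` the expected loss of the output is at most the best
expected loss plus `ε`. This is expressed as `P^n`(failure) `≤ δ`, where for a set that is not
measurable `P^n` is the outer measure; so the success event contains a measurable set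
of probability at least `1 - δ`. -/
def AgnosticPACLearnable {X Y : Type*} [MeasurableSpace X] (H : HypClass X Y)
    (ε δ : ℝ) (N : ℕ) : Prop :=
  ∃ A : (n : ℕ) → (Fin n → Sample X) → Y,
    ∀ n ≥ N, ∀ P : Measure (Sample X), IsProbabilityMeasure P →
      (Measure.pi fun _ : Fin n => P)
        {z | bestExpLoss P H + ε < expLoss P (fun x => H x (A n z))} ≤ ENNReal.ofReal δ

/-! ## Statistical classes -/

/-- The expectation of a `[0,1]`-valued function, as an element of `[0,1]`. -/
def expectation {Ω : Type*} [MeasurableSpace Ω] (μ : Measure Ω) [IsProbabilityMeasure μ]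
    (f : Ω → unitInterval) : unitInterval :=
  ⟨∫ ω, (f ω : ℝ) ∂μ, integral_nonneg fun ω => (f ω).2.1, by
    have h := integral_mono_of_nonneg (μ := μ) (f := fun ω => (f ω : ℝ)) (g := fun _ => (1 : ℝ))
      (Eventually.of_forall fun ω => (f ω).2.1) (integrable_const _)
      (Eventually.of_forall fun ω => (f ω).2.2)
    simpa using h⟩

/-- `(F ω)` is a measurable family of hypothesis classes on `X` parameterized by `Y`. -/
def IsMeasurableFamily {Ω X Y : Type*} [MeasurableSpace Ω] (F : Ω → HypClass X Y) : Prop :=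
  ∀ x y, Measurable fun ω => F ω x y

/-- The expectation class `𝔼F (x, y) = E_μ[F_ω (x, y)]`. -/
def expectationClass {Ω X Y : Type*} [MeasurableSpace Ω] (μ : Measure Ω) [IsProbabilityMeasure μ]
    (F : Ω → HypClass X Y) : HypClass X Y :=
  fun x y => expectation μ fun ω => F ω x y

/-- A distribution on the parameter space `Y`, on some σ-algebra on `Y` that makes
`y ↦ H x y` measurable for every `x`. -/
structure CompatDistribution {X Y : Type*} (H : HypClass X Y) where
  sigma : MeasurableSpace Y
  law : @Measure Y sigma
  isProb : @IsProbabilityMeasure Y sigma law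
  measurable : ∀ x, @Measurable Y unitInterval sigma _ (H x)

/-- The distribution class of `H`, on the same range space `X`:
`h_μ (x) = E_μ[y ↦ H x y]`, for a `{0,1}`-valued `H` the `μ`-probability that `H x y = 1`. -/
def distributionClass {X Y : Type*} (H : HypClass X Y) : HypClass X (CompatDistribution H) :=
  fun x ν => @expectation Y ν.sigma ν.law ν.isProb (H x)

/-- The dual distribution class of `H`, on the range space `Y`: the distribution class of the
dual class. -/
def dualDistributionClass {X Y : Type*} (H : HypClass X Y) :
    HypClass Y (CompatDistribution (dualClass H)) :=
  distributionClass (dualClass H)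

/-! ## Measurability conditions (automatic for countable parameter spaces) -/

/-- The parameter space is separable for `H`: some countable set of parameters yields every
hypothesis as a pointwise limit of a sequence. -/
def IsSeparableClass {X Y : Type*} (H : HypClass X Y) : Prop :=
  ∃ D : Set Y, D.Countable ∧ ∀ y, ∃ u : ℕ → Y, (∀ k, u k ∈ D) ∧
    ∀ x, Tendsto (fun k => H x (u k)) atTop (𝓝 (H x y))

/-- The σ-algebra on `Y` induced by `H`: the one generated by the sets `{y | H x y ∈ B}`. -/
def paramSigma {X Y : Type*} (H : HypClass X Y) : MeasurableSpace Y :=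
  ⨆ x : X, MeasurableSpace.comap (H x) inferInstance

/-- `H` is measurable as a function on `X × Y`, where `Y` carries the σ-algebra induced by `H`. -/
def IsJointlyMeasurable {X Y : Type*} [mX : MeasurableSpace X] (H : HypClass X Y) : Prop :=
  @Measurable (X × Y) unitInterval (@Prod.instMeasurableSpace X Y mX (paramSigma H)) _
    fun p => H p.1 p.2

theorem isSeparableClass_of_countable {X Y : Type*} [Countable Y] (H : HypClass X Y) :
    IsSeparableClass H :=
  ⟨Set.univ, Set.countable_univ, fun y => ⟨fun _ => y, fun _ => Set.mem_univ _,
    fun _ => tendsto_const_nhds⟩⟩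

theorem isJointlyMeasurable_of_countable {X Y : Type*} [mX : MeasurableSpace X] [Countable Y]
    (H : HypClass X Y) (hH : ∀ y, Measurable fun x => H x y) : IsJointlyMeasurable H := by
  letI : MeasurableSpace Y := paramSigma H
  have hx : ∀ x, Measurable (H x) := fun x =>
    Measurable.of_comap_le (le_iSup (fun x => MeasurableSpace.comap (H x) inferInstance) x)
  have hcl : ∀ p : Y, MeasurableSet {q : Y | ∀ x, H x q = H x p} := by
    intro p
    have key : ∀ q : Y, ∃ S : Set Y, MeasurableSet S ∧ {r : Y | ∀ x, H x r = H x p} ⊆ S ∧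
        (q ∈ S → ∀ x, H x q = H x p) := by
      intro q
      by_cases hq : ∀ x, H x q = H x p
      · exact ⟨Set.univ, MeasurableSet.univ, Set.subset_univ _, fun _ => hq⟩
      · obtain ⟨x, hxq⟩ := not_forall.mp hq
        exact ⟨H x ⁻¹' {H x p}, hx x (measurableSet_singleton _), fun r hr => hr x,
          fun h => absurd h hxq⟩
    choose S hS1 hS2 hS3 using key
    have : {r : Y | ∀ x, H x r = H x p} = ⋂ q, S q := by
      ext r
      exact ⟨fun hr => Set.mem_iInter.2 fun q => hS2 q hr,
        fun hr => hS3 r (Set.mem_iInter.1 hr r)⟩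
    rw [this]
    exact MeasurableSet.iInter hS1
  intro B hB
  have : (fun p : X × Y => H p.1 p.2) ⁻¹' B =
      ⋃ p : Y, ((fun x => H x p) ⁻¹' B) ×ˢ {q : Y | ∀ x, H x q = H x p} := by
    ext ⟨x, q⟩
    simp only [Set.mem_preimage, Set.mem_iUnion, Set.mem_prod, Set.mem_setOf_eq]
    constructor
    · exact fun h => ⟨q, h, fun _ => rfl⟩
    · rintro ⟨p, h, hq⟩
      rw [hq x]
      exact h
  rw [this]
  exact MeasurableSet.iUnion fun p => (hH p hB).prod (hcl p)

/-! ## The two bounds, with constant `C`, rounded up to an integer -/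

/-- `⌈C · (d/ε⁴ · log²(d/ε) + 1/ε² · log(1/δ))⌉` -/
def fatBound (C : ℝ) (d : ℕ) (ε δ : ℝ) : ℕ :=
  ⌈C * (d / ε ^ 4 * Real.log (d / ε) ^ 2 + 1 / ε ^ 2 * Real.log (1 / δ))⌉₊

/-- `⌈C · 1/ε² · (d · log(d/ε) + log(1/δ))⌉` -/
def vcBound (C : ℝ) (d : ℕ) (ε δ : ℝ) : ℕ :=
  ⌈C * (1 / ε ^ 2 * (d * Real.log (d / ε) + Real.log (1 / δ)))⌉₊

end

end StatLearning

open StatLearning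

open StatLearning

/-! Averages of hypotheses need not inherit the combinatorial dimension of the class they come from,
so the averaged class is not covered directly. What passes to averages is a bound on exponential
moments. With residual a = h(x) - t, the squared loss of an averaged hypothesis is (E a)^2 = E E' a
a', which is bilinear in two independent copies. In the symmetrized process these squares carry
random signs, so the resulting quadratic form is indefinite; but it is the diagonal of a form that
is linear in each copy separately, and Jensen's inequality for exp can be applied to one copy at a
time. A supremum of averages is at most the average of suprema, so a moment bound for products of
residuals of two original hypotheses transfers without loss (`ofReal_exp_loss_expectation_le`,
`symBound_expectationClass`, `symBound_distributionClass`).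

For the original classes that bound comes from finite covers on the 2n points of a sample and a
ghost sample. For concept classes these are given by Sauer-Shelah, for fat-shattering by
discretization and a count of shattered witnesses in the style of Alon, Ben-David, Cesa-Bianchi and
Haussler (`hasCover_of_vcDim_le`, `hasCover_of_fatDim_le`). Covers of size M give M^2 products,
whose sign sums are sub-Gaussian (`symBound_residualProd`).

Symmetrization and Markov's inequality then bound the maximal deviation between empirical and
expected loss, and an approximate empirical minimizer learns. Covers at scale 4ε/50 cost 16ε/50 in
the deviation, while almost ε/2 is available, so the failure probability is at most 2 M^2
exp(-nε²/300); the sample sizes make this at most δ (`agnosticPACLearnable_of_card`,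
`exists_isSampleSizeConstant`).

Uncountable suprema are avoided by passing to a countable family that approximates losses. For
mixtures it consists of finite averages, obtained from a greedy mean-square approximation
(`exists_integral_sq_sum_sub_le`). -/

namespace StatLearning

/-! ## Finite covers of classes of bounded dimension -/

/-- On the points `x k`, every hypothesis of `H` is within `α` of one of at most `M` vectors with
coordinates in `[0,1]`. -/
def HasCover {X Y ι : Type*} (H : HypClass X Y) (x : ι → X) (α : ℝ) (M : ℕ) : Prop :=
  ∃ T : Finset (ι → ℝ), T.card ≤ M ∧ (∀ c ∈ T, ∀ k, c k ∈ Set.Icc (0 : ℝ) 1) ∧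
    ∀ y, ∃ c ∈ T, ∀ k, |(H (x k) y : ℝ) - c k| ≤ α

theorem card_le_of_vcDim_le {X Y : Type*} {H : HypClass X Y} {d : ℕ} (hd : vcDim H ≤ d)
    {S : Finset X} (hS : Shatters H S) : S.card ≤ d := by
  have h : (S : Set X).encard ≤ d :=
    (le_iSup₂ (f := fun (A : Set X) (_ : Shatters H A) => A.encard) (S : Set X) hS).trans hd
  rw [Set.encard_coe_eq_coe_finsetCard] at h
  exact_mod_cast h

theorem card_le_of_fatDim_le {X Y : Type*} {H : HypClass X Y} {γ : ℝ} {d : ℕ}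
    (hd : fatDim H γ ≤ d) {S : Finset X} (hS : FatShatters H γ S) : S.card ≤ d := by
  have h : (S : Set X).encard ≤ d :=
    (le_iSup₂ (f := fun (A : Set X) (_ : FatShatters H γ A) => A.encard) (S : Set X) hS).trans hd
  rw [Set.encard_coe_eq_coe_finsetCard] at h
  exact_mod_cast h

/-- Termwise comparison with the binomial expansion of `(m + 1) ^ d`, using that `m.choose k ≤ m ^
k` and that the coefficients `d.choose k` are at least 1. -/
theorem sum_choose_le_pow (m d : ℕ) : ∑ k ∈ Finset.Iic d, m.choose k ≤ (m + 1) ^ d := by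
  have hI : Finset.Iic d = Finset.range (d + 1) := by ext; simp
  rw [add_pow, hI]
  refine Finset.sum_le_sum fun k hk => ?_
  have hk' : 0 < d.choose k := Nat.choose_pos (by simpa using hk)
  simpa using (Nat.choose_le_pow m k).trans (Nat.le_mul_of_pos_right _ hk')

/-- Sauer-Shelah for the traces on the index set. Points may repeat in `x`, but two indices of the
same point are never separated, so `x` is injective on a shattered index set and its image is a
shattered set of points. -/
theorem hasCover_of_vcDim_le {X Y ι : Type*} [Fintype ι] {H : HypClass X Y} {d : ℕ}
    (hH : IsConceptClass H) (hd : vcDim H ≤ d) (x : ι → X) :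
    HasCover H x 0 ((Fintype.card ι + 1) ^ d) := by
  classical
  let tr : Y → Finset ι := fun y => Finset.univ.filter fun k => H (x k) y = 1
  let A : Finset (Finset ι) := Finset.univ.filter fun S => ∃ y, tr y = S
  have hmem : ∀ y, tr y ∈ A := fun y => by simp [A]
  have hsh : ∀ S : Finset ι, A.Shatters S → S.card ≤ d := by
    intro S hS
    have key : ∀ t ⊆ S, ∃ y, ∀ k ∈ S, k ∈ t ↔ H (x k) y = 1 := by
      intro t ht
      obtain ⟨u, hu, hut⟩ := hS ht
      obtain ⟨y, hy⟩ := (Finset.mem_filter.1 hu).2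
      refine ⟨y, fun k hk => ?_⟩
      rw [← hut, Finset.mem_inter, ← hy]
      simp [tr, hk]
    have hinj : Set.InjOn x S := by
      intro i hi j hj hij
      obtain ⟨y, hy⟩ := key {i} (by simpa using hi)
      have h1 := (hy i hi).1 (by simp)
      rw [hij] at h1
      have := (hy j hj).2 h1
      simpa [eq_comm] using this
    rw [← Finset.card_image_of_injOn hinj]
    refine card_le_of_vcDim_le hd fun E hE => ?_
    obtain ⟨y, hy⟩ := key (S.filter fun k => x k ∈ E) (Finset.filter_subset _ _)
    refine ⟨y, fun a ha => ?_, Set.disjoint_left.2 fun a ha ha' => ?_⟩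
    · obtain ⟨k, hk, rfl⟩ := Finset.mem_image.1 (Finset.mem_coe.1 (hE ha))
      exact (hy k hk).1 (Finset.mem_filter.2 ⟨hk, ha⟩)
    · obtain ⟨k, hk, rfl⟩ := Finset.mem_image.1 (Finset.mem_coe.1 ha'.1)
      exact ha'.2 (Finset.mem_filter.1 ((hy k hk).2 ha)).2
  refine ⟨A.image fun S k => if k ∈ S then 1 else 0, ?_, ?_, fun y => ?_⟩
  · refine Finset.card_image_le.trans (A.card_le_card_shatterer.trans
      (Finset.card_shatterer_le_sum_vcDim.trans ?_))
    refine le_trans (Finset.sum_le_sum_of_subset ?_) (sum_choose_le_pow _ d)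
    exact Finset.Iic_subset_Iic.2 (Finset.sup_le fun S hS => hsh S (Finset.mem_shatterer.1 hS))
  · intro c hc k
    obtain ⟨S, -, rfl⟩ := Finset.mem_image.1 hc
    dsimp only
    split_ifs <;> simp
  · refine ⟨_, Finset.mem_image_of_mem _ (hmem y), fun k => ?_⟩
    rcases hH (x k) y with h | h <;> simp [tr, h]

/-! ### Families of functions with finitely many levels -/

/-- Distinct members of `F` differ by at least two levels at some point. -/
def LevelSeparated {ι : Type*} {L : ℕ} (F : Finset (ι → Fin L)) : Prop :=
  ∀ f ∈ F, ∀ g ∈ F, f ≠ g → ∃ i, (f i : ℕ) + 2 ≤ g i ∨ (g i : ℕ) + 2 ≤ f i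

/-- `F` shatters the domain of the partial function `p`, with the values of `p` as witness and
with values of members of `F` that are different from the witness. -/
def StronglyShatters {ι : Type*} {L : ℕ} (F : Finset (ι → Fin L)) (p : ι → Option (Fin L)) :
    Prop :=
  ∀ E : Finset ι, ∃ f ∈ F, ∀ i v, p i = some v → (i ∈ E → v < f i) ∧ (i ∉ E → f i < v)

theorem StronglyShatters.mono {ι : Type*} {L : ℕ} {F G : Finset (ι → Fin L)} (h : F ⊆ G)
    {p : ι → Option (Fin L)} (hp : StronglyShatters F p) : StronglyShatters G p := fun E =>
  let ⟨f, hf, hfp⟩ := hp E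
  ⟨f, h hf, hfp⟩

/-- A point in the domain of a shattered witness needs values on both sides of the witness, so a
coordinate on which the family is constant lies outside the domain. -/
theorem StronglyShatters.eq_none {ι : Type*} {L : ℕ} {F : Finset (ι → Fin L)}
    {p : ι → Option (Fin L)} (hp : StronglyShatters F p) {i : ι} {u : Fin L}
    (hu : ∀ f ∈ F, f i = u) : p i = none := by
  classical
  by_contra hne
  obtain ⟨v, hv⟩ := Option.ne_none_iff_exists'.1 hne
  obtain ⟨f, hf, hfp⟩ := hp {i}
  obtain ⟨g, hg, hgp⟩ := hp ∅
  have h1 := (hfp i v hv).1 (by simp)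
  have h2 := (hgp i v hv).2 (by simp)
  rw [hu f hf] at h1
  rw [hu g hg] at h2
  exact lt_asymm h1 h2

/-- The patterns that contain `i` are realized in `F₂`, the others in `F₁`. -/
theorem StronglyShatters.update {ι : Type*} [DecidableEq ι] {L : ℕ} {F F₁ F₂ : Finset (ι → Fin L)}
    (h₁ : F₁ ⊆ F) (h₂ : F₂ ⊆ F) {p : ι → Option (Fin L)} (hp₁ : StronglyShatters F₁ p)
    (hp₂ : StronglyShatters F₂ p) {i : ι} {v : Fin L} (hv₁ : ∀ f ∈ F₁, f i < v)
    (hv₂ : ∀ f ∈ F₂, v < f i) : StronglyShatters F (Function.update p i (some v)) := by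
  intro E
  by_cases hi : i ∈ E
  · obtain ⟨f, hf, hfp⟩ := hp₂ E
    refine ⟨f, h₂ hf, fun j w hj => ?_⟩
    by_cases hji : j = i
    · subst hji
      simp only [Function.update_self, Option.some.injEq] at hj
      subst hj
      exact ⟨fun _ => hv₂ f hf, fun h => absurd hi h⟩
    · rw [Function.update_of_ne hji] at hj
      exact hfp j w hj
  · obtain ⟨f, hf, hfp⟩ := hp₁ E
    refine ⟨f, h₁ hf, fun j w hj => ?_⟩
    by_cases hji : j = i
    · subst hji
      simp only [Function.update_self, Option.some.injEq] at hj
      subst hj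
      exact ⟨fun h => absurd h hi, fun _ => hv₁ f hf⟩
    · rw [Function.update_of_ne hji] at hj
      exact hfp j w hj

open Classical in
/-- If two subfamilies are separated at one point, then the numbers of witnesses that they
shatter add up. -/
theorem card_stronglyShatters_add_le {ι : Type*} [Fintype ι] {L : ℕ}
    {F F₁ F₂ : Finset (ι → Fin L)} (h₁ : F₁ ⊆ F) (h₂ : F₂ ⊆ F) {i : ι} {u w : Fin L}
    (hu : ∀ f ∈ F₁, f i = u) (hw : ∀ f ∈ F₂, f i = w) (huw : (u : ℕ) + 2 ≤ w) :
    (Finset.univ.filter (StronglyShatters F₁)).card +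
      (Finset.univ.filter (StronglyShatters F₂)).card ≤
        (Finset.univ.filter (StronglyShatters F)).card := by
  -- The gap of two levels leaves room for a witness value strictly between `u` and `w`.
  let v : Fin L := ⟨u + 1, by omega⟩
  set P₁ := Finset.univ.filter (StronglyShatters F₁) with hP₁
  set P₂ := Finset.univ.filter (StronglyShatters F₂) with hP₂
  have hinj : Set.InjOn (fun p : ι → Option (Fin L) => Function.update p i (some v))
      (P₁ ∩ P₂ : Finset _) := by
    intro p hp q hq hpq
    have hp0 := (Finset.mem_filter.1 (Finset.mem_inter.1 hp).1).2.eq_none hu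
    have hq0 := (Finset.mem_filter.1 (Finset.mem_inter.1 hq).1).2.eq_none hu
    ext1 j
    by_cases hj : j = i
    · rw [hj, hp0, hq0]
    · simpa [Function.update_of_ne hj] using congrFun hpq j
  -- A witness shattered by both subfamilies is counted twice on the left. Its second copy is
  -- accounted for by its extension to `i` with value `v`, which is shattered by `F` but by neither
  -- subfamily, since both are constant at `i`.
  rw [← Finset.card_union_add_card_inter, ← Finset.card_image_of_injOn hinj,
    ← Finset.card_union_of_disjoint]
  · refine Finset.card_le_card fun p hp => ?_
    rw [Finset.mem_filter]
    refine ⟨Finset.mem_univ _, ?_⟩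
    rcases Finset.mem_union.1 hp with hp | hp
    · rcases Finset.mem_union.1 hp with hp | hp
      · exact (Finset.mem_filter.1 hp).2.mono h₁
      · exact (Finset.mem_filter.1 hp).2.mono h₂
    · obtain ⟨q, hq, rfl⟩ := Finset.mem_image.1 hp
      obtain ⟨hq1, hq2⟩ := Finset.mem_inter.1 hq
      refine StronglyShatters.update h₁ h₂ (Finset.mem_filter.1 hq1).2 (Finset.mem_filter.1 hq2).2
        (fun f hf => ?_) (fun f hf => ?_)
      · rw [hu f hf, Fin.lt_def]
        simp [v]
      · rw [hw f hf, Fin.lt_def]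
        simp only [v]
        omega
  · rw [Finset.disjoint_left]
    intro p hp hp'
    obtain ⟨q, -, rfl⟩ := Finset.mem_image.1 hp'
    have : Function.update q i (some v) i = none := by
      rcases Finset.mem_union.1 hp with hp | hp
      · exact (Finset.mem_filter.1 hp).2.eq_none hu
      · exact (Finset.mem_filter.1 hp).2.eq_none hw
    simp at this

open Classical in
-- Each induction step pairs off the members of `F`. Every pair is separated at some point, and by
-- pigeonhole many pairs share the point and both values there. The first members and the second
-- members of these pairs form two families to which the induction hypothesis applies, and their
-- counts of witnesses add up.
theorem two_pow_le_card_stronglyShatters {ι : Type*} [Fintype ι] [Nonempty ι] {L : ℕ}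
    (hL : 0 < L) (k : ℕ) (F : Finset (ι → Fin L)) (hF : LevelSeparated F)
    (hcard : (2 * (Fintype.card ι * L ^ 2)) ^ k ≤ F.card) :
    2 ^ k ≤ (Finset.univ.filter (StronglyShatters F)).card := by
  induction k generalizing F with
  | zero =>
    rw [pow_zero, Nat.one_le_iff_ne_zero, ← Nat.pos_iff_ne_zero, Finset.card_pos]
    obtain ⟨f, hf⟩ : F.Nonempty := Finset.card_pos.1 (by simpa using hcard)
    exact ⟨fun _ => none, Finset.mem_filter.2 ⟨Finset.mem_univ _, fun E => ⟨f, hf, by simp⟩⟩⟩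
  | succ k ih =>
    set K := Fintype.card ι * L ^ 2 with hK
    set t := (2 * K) ^ k with ht
    have hle : K * t + K * t ≤ F.card := by
      calc K * t + K * t = (2 * K) ^ (k + 1) := by rw [pow_succ]; ring
        _ ≤ F.card := hcard
    let e : Fin (K * t + K * t) → (ι → Fin L) := fun j => (F.equivFin.symm (Fin.castLE hle j) : _)
    have he : Function.Injective e := fun a b hab =>
      Fin.castLE_injective hle (F.equivFin.symm.injective (Subtype.ext hab))
    have heF : ∀ j, e j ∈ F := fun j => (F.equivFin.symm _).2
    let f₁ : Fin (K * t) → (ι → Fin L) := fun j => e (Fin.castAdd _ j)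
    let f₂ : Fin (K * t) → (ι → Fin L) := fun j => e (Fin.natAdd _ j)
    have hf₁ : Function.Injective f₁ := he.comp (Fin.castAdd_injective _ _)
    have hf₂ : Function.Injective f₂ := he.comp (Fin.natAdd_injective _ _)
    have hsep : ∀ j, ∃ i, (f₁ j i : ℕ) + 2 ≤ f₂ j i ∨ (f₂ j i : ℕ) + 2 ≤ f₁ j i := by
      intro j
      refine hF _ (heF _) _ (heF _) fun h => ?_
      have := congrArg Fin.val (he h)
      simp only [Fin.val_castAdd, Fin.val_natAdd] at this
      have := j.2
      omega
    choose c hc using hsep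
    have : Nonempty (Fin L) := ⟨⟨0, hL⟩⟩
    -- There are `K` triples of a point and two levels and `K * t` pairs, so some triple is shared
    -- by at least `t` pairs.
    obtain ⟨⟨i, u, w⟩, -, hfib⟩ := Finset.exists_le_card_fiber_of_mul_le_card_of_maps_to
      (s := (Finset.univ : Finset (Fin (K * t))))
      (t := (Finset.univ : Finset (ι × Fin L × Fin L)))
      (f := fun j => (c j, f₁ j (c j), f₂ j (c j))) (n := t) (fun _ _ => Finset.mem_univ _)
      Finset.univ_nonempty (by simp [hK, pow_two, Fintype.card_prod])
    set S := Finset.univ.filter fun j => (c j, f₁ j (c j), f₂ j (c j)) = (i, u, w) with hS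
    have hSc : ∀ j ∈ S, c j = i ∧ f₁ j i = u ∧ f₂ j i = w := by
      intro j hj
      have := (Finset.mem_filter.1 hj).2
      simp only [Prod.mk.injEq] at this
      obtain ⟨h1, h2, h3⟩ := this
      rw [h1] at h2 h3
      exact ⟨h1, h2, h3⟩
    have hsub : ∀ f : Fin (K * t) → (ι → Fin L), (∀ j, f j ∈ F) → S.image f ⊆ F := by
      intro f hf g hg
      obtain ⟨j, -, rfl⟩ := Finset.mem_image.1 hg
      exact hf j
    have hval₁ : ∀ f ∈ S.image f₁, f i = u := fun f hf => by
      obtain ⟨j, hj, rfl⟩ := Finset.mem_image.1 hf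
      exact (hSc j hj).2.1
    have hval₂ : ∀ f ∈ S.image f₂, f i = w := fun f hf => by
      obtain ⟨j, hj, rfl⟩ := Finset.mem_image.1 hf
      exact (hSc j hj).2.2
    have hs₁ := hsub f₁ fun j => heF _
    have hs₂ := hsub f₂ fun j => heF _
    have ih₁ := ih (S.image f₁) (fun f hf g hg => hF f (hs₁ hf) g (hs₁ hg))
      (by rwa [Finset.card_image_of_injective _ hf₁])
    have ih₂ := ih (S.image f₂) (fun f hf g hg => hF f (hs₂ hf) g (hs₂ hg))
      (by rwa [Finset.card_image_of_injective _ hf₂])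
    have huw : (u : ℕ) + 2 ≤ w ∨ (w : ℕ) + 2 ≤ u := by
      have : S.Nonempty := by
        rw [← Finset.card_pos]
        exact lt_of_lt_of_le (by positivity) hfib
      obtain ⟨j, hj⟩ := this
      obtain ⟨h1, h2, h3⟩ := hSc j hj
      have := hc j
      rwa [h1, h2, h3] at this
    rw [pow_succ]
    rcases huw with h | h
    · have := card_stronglyShatters_add_le hs₁ hs₂ hval₁ hval₂ h
      omega
    · have := card_stronglyShatters_add_le hs₂ hs₁ hval₂ hval₁ h
      omega

open Classical in
-- A partial function with at most `d` points in its domain is determined by a list of `d` entries,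
-- each a point with a value or blank.
theorem card_stronglyShatters_le {ι : Type*} [Fintype ι] {L d : ℕ} {F : Finset (ι → Fin L)}
    (hF : ∀ p, StronglyShatters F p → (Finset.univ.filter fun i => p i ≠ none).card ≤ d) :
    (Finset.univ.filter (StronglyShatters F)).card ≤ (Fintype.card ι * L + 1) ^ d := by
  have key : ∀ p : ι → Option (Fin L), StronglyShatters F p →
      ∃ q : Fin d → Option (ι × Fin L), ∀ i v, p i = some v ↔ ∃ j, q j = some (i, v) := by
    intro p hp
    set S := Finset.univ.filter fun i => p i ≠ none with hS
    have hSd : S.card ≤ d := hF p hp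
    refine ⟨fun j => if h : (j : ℕ) < S.card then
      (p (S.equivFin.symm ⟨j, h⟩)).map fun v => ((S.equivFin.symm ⟨j, h⟩ : ι), v) else none,
      fun i v => ⟨fun hi => ?_, fun ⟨j, hj⟩ => ?_⟩⟩
    · have hiS : i ∈ S := by simp [hS, hi]
      refine ⟨⟨S.equivFin ⟨i, hiS⟩, (S.equivFin ⟨i, hiS⟩).2.trans_le hSd⟩, ?_⟩
      simp [hi]
    · dsimp only at hj
      split_ifs at hj with h
      obtain ⟨w, hw, hwe⟩ := Option.map_eq_some_iff.1 hj
      simp only [Prod.mk.injEq] at hwe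
      rw [← hwe.1, ← hwe.2, hw]
  choose! q hq using key
  have hinj : Set.InjOn q (Finset.univ.filter (StronglyShatters F) : Finset _) := by
    intro p hp p' hp' h
    ext i v
    rw [hq p (Finset.mem_filter.1 hp).2, hq p' (Finset.mem_filter.1 hp').2, h]
  rw [← Finset.card_image_of_injOn hinj]
  refine (Finset.card_le_univ _).trans ?_
  simp

/-- A level-separated family that strongly shatters only witnesses of size at most `d` is of
quasi-polynomial size. -/
theorem card_le_of_levelSeparated {ι : Type*} [Fintype ι] [Nonempty ι] {L d : ℕ} (hL : 0 < L)
    (hd : 1 ≤ d) {F : Finset (ι → Fin L)} (hsep : LevelSeparated F)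
    (hF : ∀ p, StronglyShatters F p → ∀ S : Finset ι, (∀ i ∈ S, p i ≠ none) → S.card ≤ d) :
    F.card ≤ (2 * (Fintype.card ι * L ^ 2)) ^ (d * (Nat.log 2 (Fintype.card ι * L + 1) + 1)) := by
  classical
  by_contra! h
  have h1 := two_pow_le_card_stronglyShatters hL _ F hsep h.le
  have h2 := card_stronglyShatters_le (d := d) (F := F) fun p hp => hF p hp _ fun i hi => by
    simpa using hi
  -- The exponent is chosen so that the lower bound for the number of shattered witnesses exceeds
  -- the upper bound.
  have h3 : (Fintype.card ι * L + 1) ^ d <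
      2 ^ (d * (Nat.log 2 (Fintype.card ι * L + 1) + 1)) := by
    rw [mul_comm d, pow_mul]
    exact Nat.pow_lt_pow_left (Nat.lt_pow_succ_log_self one_lt_two _) (Nat.one_le_iff_ne_zero.1 hd)
  exact absurd (h1.trans h2) (not_le.2 h3)

/-- In a separated subfamily of maximal cardinality no further member can be inserted, so every
member of `A` is within one level of it everywhere. -/
theorem exists_maximal_levelSeparated {ι : Type*} {L : ℕ} (A : Finset (ι → Fin L)) :
    ∃ F ⊆ A, LevelSeparated F ∧
      ∀ f ∈ A, ∃ g ∈ F, ∀ i, (f i : ℕ) < g i + 2 ∧ (g i : ℕ) < f i + 2 := by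
  classical
  obtain ⟨F, hF, hmax⟩ := (A.powerset.filter LevelSeparated).exists_max_image Finset.card
    ⟨∅, by simp [LevelSeparated]⟩
  obtain ⟨hFA, hsep⟩ := Finset.mem_filter.1 hF
  rw [Finset.mem_powerset] at hFA
  refine ⟨F, hFA, hsep, fun f hf => ?_⟩
  by_cases hfF : f ∈ F
  · exact ⟨f, hfF, fun i => by omega⟩
  by_contra! hcon
  have hins : LevelSeparated (insert f F) := by
    have hfg : ∀ g ∈ F, ∃ i, (f i : ℕ) + 2 ≤ g i ∨ (g i : ℕ) + 2 ≤ f i := by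
      intro g hg
      obtain ⟨i, hi⟩ := hcon g hg
      exact ⟨i, by by_cases h : (f i : ℕ) < g i + 2 <;> [have := hi h; skip] <;> omega⟩
    intro a ha b hb hab
    rcases Finset.mem_insert.1 ha with rfl | ha' <;> rcases Finset.mem_insert.1 hb with rfl | hb'
    · exact absurd rfl hab
    · exact hfg b hb'
    · obtain ⟨i, hi⟩ := hfg a ha'
      exact ⟨i, hi.symm⟩
    · exact hsep a ha' b hb' hab
  have := hmax (insert f F)
    (Finset.mem_filter.2 ⟨Finset.mem_powerset.2 (Finset.insert_subset hf hFA), hins⟩)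
  rw [Finset.card_insert_of_notMem hfF] at this
  omega

/-- Values are rounded down to levels of width `2 * γ`. Strict inequality with a level `v` becomes a
margin `γ` around the midpoint of its interval, so strong shattering of levels is
`γ`-fat-shattering. A maximal separated family of level vectors is therefore small, and real values
whose levels differ by at most one are within `4 * γ`. -/
theorem hasCover_of_fatDim_le {X Y ι : Type*} [Fintype ι] [Nonempty ι] {H : HypClass X Y}
    {γ : ℝ} {d L : ℕ} (hγ : 0 < γ) (hL : 1 / (2 * γ) < L) (hd1 : 1 ≤ d) (hd : fatDim H γ ≤ d)
    (x : ι → X) :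
    HasCover H x (4 * γ)
      ((2 * (Fintype.card ι * L ^ 2)) ^ (d * (Nat.log 2 (Fintype.card ι * L + 1) + 1))) := by
  classical
  have hγ2 : 0 < 2 * γ := by positivity
  have hfl : ∀ a y, ⌊(H a y : ℝ) / (2 * γ)⌋₊ < L := fun a y => by
    rw [Nat.floor_lt (div_nonneg (H a y).2.1 hγ2.le)]
    exact lt_of_le_of_lt (by gcongr; exact (H a y).2.2) hL
  let r : Y → X → Fin L := fun y a => ⟨_, hfl a y⟩
  have hr1 : ∀ y a, 2 * γ * (r y a : ℕ) ≤ H a y := fun y a => by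
    have := Nat.floor_le (div_nonneg (H a y).2.1 hγ2.le)
    rw [le_div_iff₀ hγ2] at this
    simpa [r, mul_comm] using this
  have hr2 : ∀ y a, (H a y : ℝ) < 2 * γ * ((r y a : ℕ) + 1) := fun y a => by
    have := Nat.lt_floor_add_one ((H a y : ℝ) / (2 * γ))
    rw [div_lt_iff₀ hγ2] at this
    simpa [r, mul_comm] using this
  obtain ⟨F, hFA, hsep, hmax⟩ := exists_maximal_levelSeparated
    (Finset.univ.filter fun f : ι → Fin L => ∃ y, ∀ k, r y (x k) = f k)
  have hrep : ∀ f : F, ∃ y, ∀ k, r y (x k) = f.1 k := fun f => (Finset.mem_filter.1 (hFA f.2)).2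
  have hcardS : ∀ p, StronglyShatters F p → ∀ S : Finset ι, (∀ i ∈ S, p i ≠ none) →
      S.card ≤ d := by
    intro p hp S hS
    have hp' : ∀ E : Finset ι, ∃ y, ∀ i v, p i = some v →
        (i ∈ E → v < r y (x i)) ∧ (i ∉ E → r y (x i) < v) := by
      intro E
      obtain ⟨f, hf, hfp⟩ := hp E
      obtain ⟨y, hy⟩ := hrep ⟨f, hf⟩
      refine ⟨y, fun i v hi => ?_⟩
      rw [hy]
      exact hfp i v hi
    -- If two indices had the same point, the patterns `{i}` and `{j}` would force both `v < w` and
    -- `w < v` for their witness levels.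
    have hinj : Set.InjOn x S := by
      intro i hi j hj hij
      by_contra hne
      obtain ⟨v, hv⟩ := Option.ne_none_iff_exists'.1 (hS i hi)
      obtain ⟨w, hw⟩ := Option.ne_none_iff_exists'.1 (hS j hj)
      obtain ⟨y, hy⟩ := hp' {i}
      obtain ⟨y', hy'⟩ := hp' {j}
      have h1 := (hy i v hv).1 (by simp)
      have h2 := (hy j w hw).2 (by simp [Ne.symm hne])
      have h3 := (hy' i v hv).2 (by simp [hne])
      have h4 := (hy' j w hw).1 (by simp)
      rw [hij] at h1 h3
      exact lt_asymm (h1.trans h2) (h4.trans h3)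
    have hwit : ∀ a ∈ S.image x, ∃ s : unitInterval, ∃ i ∈ S, ∃ v, x i = a ∧ p i = some v ∧
        (s : ℝ) = 2 * γ * (v : ℕ) + γ := by
      intro a ha
      obtain ⟨i, hi, rfl⟩ := Finset.mem_image.1 ha
      obtain ⟨v, hv⟩ := Option.ne_none_iff_exists'.1 (hS i hi)
      -- The midpoint is at most 1 because the pattern `{i}` is realized by a hypothesis whose value
      -- there is at least the midpoint plus `γ`.
      refine ⟨⟨2 * γ * (v : ℕ) + γ, by positivity, ?_⟩, i, hi, v, rfl, hv, rfl⟩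
      obtain ⟨y, hy⟩ := hp' {i}
      have h1 : ((v : ℕ) : ℝ) + 1 ≤ (r y (x i) : ℕ) := by exact_mod_cast (hy i v hv).1 (by simp)
      have h2 := hr1 y (x i)
      have h3 := (H (x i) y).2.2
      nlinarith
    choose! s hs using hwit
    rw [← Finset.card_image_of_injOn hinj]
    refine card_le_of_fatDim_le hd ⟨s, fun E hE => ?_⟩
    obtain ⟨y, hy⟩ := hp' (S.filter fun i => x i ∈ E)
    refine ⟨y, fun a ha => ?_, fun a ha => ?_⟩
    · obtain ⟨i, hi, v, rfl, hv, hsv⟩ := hs a ha.1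
      have h1 : ((r y (x i) : ℕ) : ℝ) + 1 ≤ (v : ℕ) := by
        exact_mod_cast (hy i v hv).2 (by simp [ha.2])
      have h2 := hr2 y (x i)
      rw [hsv]
      nlinarith
    · obtain ⟨i, hi, v, rfl, hv, hsv⟩ := hs a (hE ha)
      have h1 : ((v : ℕ) : ℝ) + 1 ≤ (r y (x i) : ℕ) := by
        exact_mod_cast (hy i v hv).1 (by simp [ha, hi])
      have h2 := hr1 y (x i)
      rw [hsv]
      nlinarith
  choose rep hrep using hrep
  have hL0 : 0 < L := by
    have : (0 : ℝ) < L := lt_trans (by positivity) hL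
    exact_mod_cast this
  refine ⟨F.attach.image fun f k => (H (x k) (rep f) : ℝ), ?_, ?_, fun y => ?_⟩
  · refine Finset.card_image_le.trans ?_
    rw [Finset.card_attach]
    exact card_le_of_levelSeparated hL0 hd1 hsep hcardS
  · intro c hc k
    obtain ⟨f, -, rfl⟩ := Finset.mem_image.1 hc
    exact (H (x k) (rep f)).2
  · obtain ⟨g, hg, hgy⟩ := hmax (fun k => r y (x k))
      (Finset.mem_filter.2 ⟨Finset.mem_univ _, y, fun _ => rfl⟩)
    refine ⟨_, Finset.mem_image_of_mem _ (Finset.mem_attach _ ⟨g, hg⟩), fun k => ?_⟩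
    obtain ⟨h1, h2⟩ := hgy k
    have hgk : g k = r (rep ⟨g, hg⟩) (x k) := (hrep ⟨g, hg⟩ k).symm
    rw [hgk] at h1 h2
    have h1' : ((r y (x k) : ℕ) : ℝ) ≤ (r (rep ⟨g, hg⟩) (x k) : ℕ) + 1 := by
      exact_mod_cast Nat.lt_succ_iff.1 h1
    have h2' : ((r (rep ⟨g, hg⟩) (x k) : ℕ) : ℝ) ≤ (r y (x k) : ℕ) + 1 := by
      exact_mod_cast Nat.lt_succ_iff.1 h2
    have a1 := hr1 y (x k)
    have a2 := hr2 y (x k)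
    have b1 := hr1 (rep ⟨g, hg⟩) (x k)
    have b2 := hr2 (rep ⟨g, hg⟩) (x k)
    rw [abs_le]
    constructor <;> nlinarith

/-- Otherwise the midpoint of the two values witnesses that the single point `x` is fat-shattered.
-/
theorem sub_le_of_fatDim_le_zero {X Y : Type*} {H : HypClass X Y} {γ : ℝ} (hd : fatDim H γ ≤ 0)
    (x : X) (y y' : Y) : (H x y : ℝ) - H x y' ≤ 2 * γ := by
  by_contra! h
  have : FatShatters H γ (({x} : Finset X) : Set X) := by
    refine ⟨fun _ => ⟨((H x y : ℝ) + H x y') / 2, ?_, ?_⟩, fun E hE => ?_⟩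
    · linarith [(H x y).2.1, (H x y').2.1]
    · linarith [(H x y).2.2, (H x y').2.2]
    · by_cases hx : x ∈ E
      · refine ⟨y, fun a ha => ?_, fun a ha => ?_⟩
        · have : a = x := by simpa using ha.1
          exact absurd (this ▸ hx) ha.2
        · have : a = x := by simpa using hE ha
          subst this
          simp only
          linarith
      · refine ⟨y', fun a ha => ?_, fun a ha => ?_⟩
        · have : a = x := by simpa using ha.1
          subst this
          simp only
          linarith
        · have : a = x := by simpa using hE ha
          exact absurd (this ▸ ha) hx
  have := card_le_of_fatDim_le (d := 0) (by simpa using hd) this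
  simp at this

/-- With a positive margin around a witness in `[0,1]`, a value above must be 1 and a value below
must be 0. -/
theorem fatDim_le_vcDim {X Y : Type*} {H : HypClass X Y} (hH : IsConceptClass H) {γ : ℝ}
    (hγ : 0 < γ) : fatDim H γ ≤ vcDim H := by
  refine iSup₂_le fun A ⟨s, hs⟩ =>
    le_iSup₂ (f := fun (A : Set X) (_ : Shatters H A) => A.encard) A fun E hE => ?_
  obtain ⟨y, hy1, hy2⟩ := hs E hE
  refine ⟨y, fun a ha => ?_, Set.disjoint_left.2 fun a ha ha' => ?_⟩
  · rcases hH a y with h | h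
    · have := hy2 a ha
      rw [h] at this
      have h0 := (s a).2.1
      simp only [Set.Icc.coe_zero] at this
      linarith
    · exact h
  · have := hy1 a ha'
    have ha1 : H a y = 1 := ha
    rw [ha1] at this
    have h0 := (s a).2.2
    simp only [Set.Icc.coe_one] at this
    linarith

/-! ## Exponential moments of sign averages -/

/-- The sign `±1` of a Boolean. -/
def boolSign (b : Bool) : ℝ := if b then 1 else -1

theorem abs_boolSign (b : Bool) : |boolSign b| = 1 := by cases b <;> simp [boolSign]

/-- The sum over signs factors into hyperbolic cosines, and cosh s ≤ exp(s²/2). -/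
theorem sum_exp_boolSign_le {n : ℕ} {w : Fin n → ℝ} {c : ℝ} (hw : ∀ k, |w k| ≤ c) (r : ℝ) :
    ∑ σ : Fin n → Bool, Real.exp (r * ∑ k, boolSign (σ k) * w k) ≤
      2 ^ n * Real.exp (r ^ 2 * c ^ 2 / 2 * n) := by
  have h1 : ∀ σ : Fin n → Bool, Real.exp (r * ∑ k, boolSign (σ k) * w k) =
      ∏ k, Real.exp (r * (boolSign (σ k) * w k)) := fun σ => by
    rw [Finset.mul_sum, Real.exp_sum]
  simp_rw [h1]
  have h2 := Finset.prod_univ_sum (fun _ : Fin n => (Finset.univ : Finset Bool))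
    fun k b => Real.exp (r * (boolSign b * w k))
  rw [Fintype.piFinset_univ] at h2
  rw [← h2]
  calc ∏ k, ∑ b : Bool, Real.exp (r * (boolSign b * w k))
      ≤ ∏ _k : Fin n, (2 * Real.exp (r ^ 2 * c ^ 2 / 2)) := by
        refine Finset.prod_le_prod (fun k _ => by positivity) fun k _ => ?_
        have h3 : ∑ b : Bool, Real.exp (r * (boolSign b * w k)) = 2 * Real.cosh (r * w k) := by
          rw [Real.cosh_eq]
          simp [boolSign]
          ring
        rw [h3]
        refine mul_le_mul_of_nonneg_left ((Real.cosh_le_exp_half_sq _).trans ?_) zero_le_two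
        have h4 : (w k) ^ 2 ≤ c ^ 2 := sq_le_sq' (abs_le.1 (hw k)).1 (abs_le.1 (hw k)).2
        rw [Real.exp_le_exp, mul_pow]
        gcongr
    _ = 2 ^ n * Real.exp (r ^ 2 * c ^ 2 / 2 * n) := by
        rw [Finset.prod_const, Finset.card_univ, Fintype.card_fin, mul_pow, ← Real.exp_nat_mul]
        ring_nf

/-- A bound on the exponential moments of the symmetrized process of a class of functions,
uniform over pairs of samples of size `n`. -/
def SymBound {I Z : Type*} (g : I → Z → ℝ) (n : ℕ) (r : ℝ) (B : ENNReal) : Prop :=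
  ∀ z z' : Fin n → Z, ∑ σ : Fin n → Bool, ⨆ i, ENNReal.ofReal
    (Real.exp (r * ∑ k, boolSign (σ k) * (g i (z' k) - g i (z k)))) ≤ 2 ^ n * B

theorem abs_mul_sub_mul_le {a b c e t α : ℝ} (hb : b ∈ Set.Icc (0 : ℝ) 1)
    (hc : c ∈ Set.Icc (0 : ℝ) 1) (ht : t ∈ Set.Icc (0 : ℝ) 1) (hac : |a - c| ≤ α) (hbe : |b - e| ≤ α) :
    |(a - t) * (b - t) - (c - t) * (e - t)| ≤ 2 * α := by
  have h : (a - t) * (b - t) - (c - t) * (e - t) = (a - c) * (b - t) + (c - t) * (b - e) := by ring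
  have hbt : |b - t| ≤ 1 := abs_le.2 ⟨by linarith [hb.1, ht.2], by linarith [hb.2, ht.1]⟩
  have hct : |c - t| ≤ 1 := abs_le.2 ⟨by linarith [hc.1, ht.2], by linarith [hc.2, ht.1]⟩
  rw [h]
  refine (abs_add_le _ _).trans ?_
  rw [abs_mul, abs_mul]
  nlinarith [abs_nonneg (a - c), abs_nonneg (b - e), abs_nonneg (b - t), abs_nonneg (c - t)]

/-- The products of the residuals of two classes. -/
def residualProd {X Y₁ Y₂ : Type*} (H₁ : HypClass X Y₁) (H₂ : HypClass X Y₂) :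
    Y₁ × Y₂ → Sample X → ℝ :=
  fun p z => ((H₁ z.1 p.1 : ℝ) - z.2) * ((H₂ z.1 p.2 : ℝ) - z.2)

theorem symBound_residualProd {X Y₁ Y₂ : Type*} {H₁ : HypClass X Y₁} {H₂ : HypClass X Y₂} {n : ℕ}
    {α : ℝ} {M : ℕ} (h₁ : ∀ x : Fin n ⊕ Fin n → X, HasCover H₁ x α M)
    (h₂ : ∀ x : Fin n ⊕ Fin n → X, HasCover H₂ x α M) (r : ℝ) :
    SymBound (residualProd H₁ H₂) n r
      (ENNReal.ofReal ((M : ℝ) ^ 2 * Real.exp (4 * α * |r| * n + 2 * r ^ 2 * n))) := by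
  intro z z'
  let x : Fin n ⊕ Fin n → X := Sum.elim (fun k => (z k).1) fun k => (z' k).1
  obtain ⟨T₁, hT₁, hc₁, hy₁⟩ := h₁ x
  obtain ⟨T₂, hT₂, hc₂, hy₂⟩ := h₂ x
  let w : (Fin n ⊕ Fin n → ℝ) × (Fin n ⊕ Fin n → ℝ) → Fin n → ℝ := fun c k =>
    (c.1 (.inr k) - (z' k).2) * (c.2 (.inr k) - (z' k).2) -
      (c.1 (.inl k) - (z k).2) * (c.2 (.inl k) - (z k).2)
  have hw : ∀ c ∈ T₁ ×ˢ T₂, ∀ k, |w c k| ≤ 2 := by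
    intro c hc k
    obtain ⟨hc1, hc2⟩ := Finset.mem_product.1 hc
    have hb : ∀ (s : Fin n ⊕ Fin n) (t : unitInterval),
        |(c.1 s - t) * (c.2 s - t)| ≤ 1 := by
      intro s t
      have a1 := hc₁ _ hc1 s
      have a2 := hc₂ _ hc2 s
      rw [abs_mul]
      refine mul_le_one₀ (abs_le.2 ⟨?_, ?_⟩) (abs_nonneg _) (abs_le.2 ⟨?_, ?_⟩) <;>
        linarith [a1.1, a1.2, a2.1, a2.2, t.2.1, t.2.2]
    refine (abs_sub _ _).trans ?_
    linarith [hb (.inr k) (z' k).2, hb (.inl k) (z k).2]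
  -- Replacing both hypotheses by cover elements changes a product of residuals by at most `2 * α`,
  -- hence each difference of two products by at most `4 * α`. At that price the supremum is
  -- dominated by a finite sum.
  have hsup : ∀ σ : Fin n → Bool, ⨆ i, ENNReal.ofReal (Real.exp (r * ∑ k, boolSign (σ k) *
      (residualProd H₁ H₂ i (z' k) - residualProd H₁ H₂ i (z k)))) ≤
      ∑ c ∈ T₁ ×ˢ T₂, ENNReal.ofReal (Real.exp (4 * α * |r| * n) *
        Real.exp (r * ∑ k, boolSign (σ k) * w c k)) := by
    intro σ
    refine iSup_le fun ⟨y₁, y₂⟩ => ?_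
    obtain ⟨c₁, hm₁, hd₁⟩ := hy₁ y₁
    obtain ⟨c₂, hm₂, hd₂⟩ := hy₂ y₂
    refine le_trans ?_ (Finset.single_le_sum (fun _ _ => zero_le)
      (Finset.mk_mem_product hm₁ hm₂))
    refine ENNReal.ofReal_le_ofReal ?_
    rw [← Real.exp_add, Real.exp_le_exp]
    have hd : ∀ k, |(residualProd H₁ H₂ (y₁, y₂) (z' k) - residualProd H₁ H₂ (y₁, y₂) (z k)) -
        w (c₁, c₂) k| ≤ 4 * α := by
      intro k
      have a1 := abs_mul_sub_mul_le (a := (H₁ (z' k).1 y₁ : ℝ)) (H₂ (z' k).1 y₂).2 (hc₁ _ hm₁ (.inr k)) (z' k).2.2 (hd₁ (.inr k)) (hd₂ (.inr k))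
      have a2 := abs_mul_sub_mul_le (a := (H₁ (z k).1 y₁ : ℝ)) (H₂ (z k).1 y₂).2 (hc₁ _ hm₁ (.inl k)) (z k).2.2 (hd₁ (.inl k)) (hd₂ (.inl k))
      rw [abs_le] at a1 a2 ⊢
      simp only [residualProd, w]
      constructor <;> linarith [a1.1, a1.2, a2.1, a2.2]
    have hdiff : r * ∑ k, boolSign (σ k) *
        (residualProd H₁ H₂ (y₁, y₂) (z' k) - residualProd H₁ H₂ (y₁, y₂) (z k)) -
        r * ∑ k, boolSign (σ k) * w (c₁, c₂) k ≤ |r| * (n * (4 * α)) := by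
      rw [← mul_sub, ← Finset.sum_sub_distrib]
      refine (le_abs_self _).trans ?_
      rw [abs_mul]
      refine mul_le_mul_of_nonneg_left ((Finset.abs_sum_le_sum_abs _ _).trans ?_) (abs_nonneg _)
      calc _ ≤ ∑ _k : Fin n, 4 * α := by
            refine Finset.sum_le_sum fun k _ => ?_
            rw [← mul_sub, abs_mul, abs_boolSign, one_mul]
            exact hd k
        _ = n * (4 * α) := by simp
    linarith
  calc _ ≤ ∑ σ : Fin n → Bool, ∑ c ∈ T₁ ×ˢ T₂, ENNReal.ofReal (Real.exp (4 * α * |r| * n) *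
        Real.exp (r * ∑ k, boolSign (σ k) * w c k)) := Finset.sum_le_sum fun σ _ => hsup σ
    _ = ∑ c ∈ T₁ ×ˢ T₂, ENNReal.ofReal (Real.exp (4 * α * |r| * n) *
        ∑ σ : Fin n → Bool, Real.exp (r * ∑ k, boolSign (σ k) * w c k)) := by
        rw [Finset.sum_comm]
        refine Finset.sum_congr rfl fun c _ => ?_
        rw [Finset.mul_sum, ENNReal.ofReal_sum_of_nonneg fun _ _ => by positivity]
    _ ≤ ∑ _c ∈ T₁ ×ˢ T₂, ENNReal.ofReal (Real.exp (4 * α * |r| * n) *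
        (2 ^ n * Real.exp (2 * r ^ 2 * n))) := by
        refine Finset.sum_le_sum fun c hc => ENNReal.ofReal_le_ofReal
          (mul_le_mul_of_nonneg_left ?_ (Real.exp_pos _).le)
        refine (sum_exp_boolSign_le (hw c hc) r).trans_eq ?_
        rw [show r ^ 2 * 2 ^ 2 / 2 * (n : ℝ) = 2 * r ^ 2 * n by ring]
    _ = ENNReal.ofReal (((T₁ ×ˢ T₂).card : ℝ) * (Real.exp (4 * α * |r| * n) *
        (2 ^ n * Real.exp (2 * r ^ 2 * n)))) := by
        rw [Finset.sum_const, nsmul_eq_mul, ENNReal.ofReal_mul (Nat.cast_nonneg _),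
          ENNReal.ofReal_natCast]
    _ ≤ ENNReal.ofReal (2 ^ n * ((M : ℝ) ^ 2 * Real.exp (4 * α * |r| * n + 2 * r ^ 2 * n))) := by
        refine ENNReal.ofReal_le_ofReal ?_
        have hcard : ((T₁ ×ˢ T₂).card : ℝ) ≤ (M : ℝ) ^ 2 := by
          rw [Finset.card_product, pow_two]
          exact_mod_cast Nat.mul_le_mul hT₁ hT₂
        rw [Real.exp_add]
        calc _ ≤ (M : ℝ) ^ 2 * (Real.exp (4 * α * |r| * n) *
              (2 ^ n * Real.exp (2 * r ^ 2 * n))) := by gcongr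
          _ = _ := by ring
    _ = _ := by
        rw [ENNReal.ofReal_mul (by positivity), ENNReal.ofReal_pow zero_le_two,
          ENNReal.ofReal_ofNat]

/-! ## From a class to its averages -/

/-- Jensen's inequality from the tangent line of exp at the mean. The right side is a lower Lebesgue
integral, so exp ∘ f need not be integrable. -/
theorem ofReal_exp_integral_le {Ω : Type*} [MeasurableSpace Ω] {μ : Measure Ω}
    [IsProbabilityMeasure μ] {f : Ω → ℝ} (hf : Integrable f μ) :
    ENNReal.ofReal (Real.exp (∫ ω, f ω ∂μ)) ≤ ∫⁻ ω, ENNReal.ofReal (Real.exp (f ω)) ∂μ := by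
  set c := ∫ ω, f ω ∂μ with hc
  have h1 : Integrable (fun ω => Real.exp c * (1 + (f ω - c))) μ :=
    ((integrable_const _).add (hf.sub (integrable_const _))).const_mul _
  have h2 : ∫ ω, Real.exp c * (1 + (f ω - c)) ∂μ = Real.exp c := by
    have h3 : ∫ ω, (1 + (f ω - c)) ∂μ = ∫ _ω, (1 : ℝ) ∂μ + (∫ ω, f ω ∂μ - ∫ _ω, c ∂μ) := by
      rw [← integral_sub hf (integrable_const _)]
      exact integral_add (integrable_const _) (hf.sub (integrable_const _))
    rw [integral_const_mul, h3]
    simp [hc]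
  calc ENNReal.ofReal (Real.exp c)
      = ENNReal.ofReal (∫ ω, Real.exp c * (1 + (f ω - c)) ∂μ) := by rw [h2]
    _ ≤ ENNReal.ofReal (∫ ω, max (Real.exp c * (1 + (f ω - c))) 0 ∂μ) :=
        ENNReal.ofReal_le_ofReal (integral_mono h1 h1.pos_part fun ω => le_max_left _ _)
    _ = ∫⁻ ω, ENNReal.ofReal (max (Real.exp c * (1 + (f ω - c))) 0) ∂μ :=
        ofReal_integral_eq_lintegral_ofReal h1.pos_part
          (Eventually.of_forall fun ω => le_max_right _ _)
    _ ≤ ∫⁻ ω, ENNReal.ofReal (Real.exp (f ω)) ∂μ := by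
        refine lintegral_mono fun ω => ENNReal.ofReal_le_ofReal
          (max_le ?_ (Real.exp_pos _).le)
        have h3 : Real.exp (f ω) = Real.exp c * Real.exp (f ω - c) := by
          rw [← Real.exp_add]
          ring_nf
        rw [h3]
        refine mul_le_mul_of_nonneg_left ?_ (Real.exp_pos _).le
        linarith [Real.add_one_le_exp (f ω - c)]

/-- For functions `a k`, the exponential of a diagonal quadratic form in their expectations is at
most the double average of the exponential of the bilinear form. -/
theorem ofReal_exp_sum_sq_integral_le {Ω ι : Type*} [MeasurableSpace Ω] [Fintype ι]
    {μ : Measure Ω} [IsProbabilityMeasure μ] {a : ι → Ω → ℝ} (ha : ∀ k, Integrable (a k) μ)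
    (b : ι → ℝ) :
    ENNReal.ofReal (Real.exp (∑ k, b k * (∫ ω, a k ω ∂μ) ^ 2)) ≤
      ∫⁻ ω, ∫⁻ ω', ENNReal.ofReal (Real.exp (∑ k, b k * (a k ω * a k ω'))) ∂μ ∂μ := by
  have key : ∀ b' : ι → ℝ, ENNReal.ofReal (Real.exp (∑ k, b' k * ∫ ω, a k ω ∂μ)) ≤
      ∫⁻ ω, ENNReal.ofReal (Real.exp (∑ k, b' k * a k ω)) ∂μ := by
    intro b'
    have h1 : ∫ ω, ∑ k, b' k * a k ω ∂μ = ∑ k, b' k * ∫ ω, a k ω ∂μ := by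
      rw [integral_finsetSum _ fun k _ => (ha k).const_mul _]
      simp_rw [integral_const_mul]
    rw [← h1]
    exact ofReal_exp_integral_le (integrable_finsetSum _ fun k _ => (ha k).const_mul _)
  -- The coefficients `b k` may be negative, so the quadratic form need not be convex. Freezing one
  -- factor of each square leaves a linear form in the other, to which Jensen applies; then the
  -- roles are exchanged.
  calc _ = ENNReal.ofReal (Real.exp (∑ k, (b k * ∫ ω, a k ω ∂μ) * ∫ ω, a k ω ∂μ)) := by
        simp_rw [pow_two, mul_assoc]
    _ ≤ ∫⁻ ω, ENNReal.ofReal (Real.exp (∑ k, (b k * ∫ ω, a k ω ∂μ) * a k ω)) ∂μ := key _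
    _ = ∫⁻ ω, ENNReal.ofReal (Real.exp (∑ k, (b k * a k ω) * ∫ ω', a k ω' ∂μ)) ∂μ := by
        simp_rw [mul_right_comm]
    _ ≤ ∫⁻ ω, ∫⁻ ω', ENNReal.ofReal (Real.exp (∑ k, (b k * a k ω) * a k ω')) ∂μ ∂μ :=
        lintegral_mono fun ω => key _
    _ = _ := by simp_rw [mul_assoc]

/-- The loss of the expectation of a random hypothesis, in exponential moments. -/
theorem ofReal_exp_loss_expectation_le {Ω X : Type*} [MeasurableSpace Ω] {μ : Measure Ω}
    [IsProbabilityMeasure μ] {h : X → Ω → unitInterval} (hh : ∀ x, Measurable (h x)) {n : ℕ}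
    (z z' : Fin n → Sample X) (σ : Fin n → Bool) (r : ℝ) :
    ENNReal.ofReal (Real.exp (r * ∑ k, boolSign (σ k) *
      (loss (fun x => expectation μ (h x)) (z' k) -
        loss (fun x => expectation μ (h x)) (z k)))) ≤
    ∫⁻ ω, ∫⁻ ω', ENNReal.ofReal (Real.exp (r * ∑ k, boolSign (σ k) *
      (residualProd h h (ω, ω') (z' k) - residualProd h h (ω, ω') (z k)))) ∂μ ∂μ := by
  -- Sample and ghost sample are put on one index set, so that the signed difference of losses
  -- becomes a diagonal quadratic form in mean residuals.
  let zz : Fin n ⊕ Fin n → Sample X := Sum.elim z z'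
  let b : Fin n ⊕ Fin n → ℝ :=
    Sum.elim (fun k => r * (boolSign (σ k) * (-1))) fun k => r * boolSign (σ k)
  have hint : ∀ x, Integrable (fun ω => (h x ω : ℝ)) μ := fun x =>
    Integrable.of_bound (measurable_subtype_coe.comp (hh x)).aestronglyMeasurable 1
      (Eventually.of_forall fun ω => by
        rw [Real.norm_eq_abs, abs_of_nonneg (h x ω).2.1]; exact (h x ω).2.2)
  have := ofReal_exp_sum_sq_integral_le (μ := μ) (a := fun k ω => (h (zz k).1 ω : ℝ) - (zz k).2)
    (fun k => (hint _).sub (integrable_const _)) b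
  convert this using 2
  · congr 1
    simp only [Fintype.sum_sum_type, b, zz, Sum.elim_inl, Sum.elim_inr, loss, expectation]
    rw [Finset.mul_sum, ← Finset.sum_add_distrib]
    refine Finset.sum_congr rfl fun k _ => ?_
    rw [integral_sub (hint _) (integrable_const _), integral_sub (hint _) (integrable_const _)]
    simp
    ring
  · ext ω
    congr 1
    ext ω'
    congr 2
    simp only [Fintype.sum_sum_type, b, zz, Sum.elim_inl, Sum.elim_inr, residualProd]
    rw [Finset.mul_sum, ← Finset.sum_add_distrib]
    exact Finset.sum_congr rfl fun k _ => by ring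

/-- This direction holds without measurability of the summands, which matters because it is applied
to suprema over an arbitrary parameter space. -/
theorem sum_lintegral_le {Ω ι : Type*} [MeasurableSpace Ω] {μ : Measure Ω} (s : Finset ι)
    (f : ι → Ω → ENNReal) : ∑ i ∈ s, ∫⁻ ω, f i ω ∂μ ≤ ∫⁻ ω, ∑ i ∈ s, f i ω ∂μ := by
  classical
  induction s using Finset.induction_on with
  | empty => simp
  | insert a s ha ih =>
    simp_rw [Finset.sum_insert ha]
    exact (add_le_add_right ih _).trans (le_lintegral_add _ _)

theorem symBound_expectationClass {Ω X Y : Type*} [MeasurableSpace Ω] {μ : Measure Ω}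
    [IsProbabilityMeasure μ] {F : Ω → HypClass X Y} (hF : IsMeasurableFamily F) {n : ℕ} {r : ℝ}
    {B : ENNReal} (hB : ∀ ω ω', SymBound (residualProd (F ω) (F ω')) n r B) :
    SymBound (fun y => loss fun x => expectationClass μ F x y) n r B := by
  intro z z'
  let G : Ω → Ω → (Fin n → Bool) → ENNReal := fun ω ω' σ => ⨆ p : Y × Y, ENNReal.ofReal
    (Real.exp (r * ∑ k, boolSign (σ k) *
      (residualProd (F ω) (F ω') p (z' k) - residualProd (F ω) (F ω') p (z k))))
  calc _ ≤ ∑ σ : Fin n → Bool, ∫⁻ ω, ∫⁻ ω', G ω ω' σ ∂μ ∂μ := by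
        refine Finset.sum_le_sum fun σ _ => iSup_le fun y => ?_
        refine (ofReal_exp_loss_expectation_le (μ := μ) (h := fun x ω => F ω x y)
          (fun x => hF x y) z z' σ r).trans ?_
        refine lintegral_mono fun ω => lintegral_mono fun ω' => ?_
        exact le_iSup (fun p : Y × Y => ENNReal.ofReal
          (Real.exp (r * ∑ k, boolSign (σ k) *
          (residualProd (F ω) (F ω') p (z' k) - residualProd (F ω) (F ω') p (z k))))) (y, y)
    _ ≤ ∫⁻ ω, ∫⁻ ω', ∑ σ : Fin n → Bool, G ω ω' σ ∂μ ∂μ :=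
        (sum_lintegral_le _ _).trans (lintegral_mono fun ω => sum_lintegral_le _ _)
    _ ≤ ∫⁻ _ω, ∫⁻ _ω', 2 ^ n * B ∂μ ∂μ :=
        lintegral_mono fun ω => lintegral_mono fun ω' => hB ω ω' z z'
    _ = 2 ^ n * B := by simp

theorem symBound_distributionClass {X Y : Type*} {H : HypClass X Y} {n : ℕ} {r : ℝ}
    {B : ENNReal} (hB : SymBound (residualProd H H) n r B) :
    SymBound (fun ν => loss fun x => distributionClass H x ν) n r B := by
  intro z z'
  refine le_trans (Finset.sum_le_sum fun σ _ => iSup_le fun ν => ?_) (hB z z')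
  let _ := ν.sigma
  have := ν.isProb
  refine (ofReal_exp_loss_expectation_le (μ := ν.law) (h := H) ν.measurable z z' σ r).trans ?_
  set S := ⨆ p : Y × Y, ENNReal.ofReal (Real.exp (r * ∑ k, boolSign (σ k) *
      (residualProd H H p (z' k) - residualProd H H p (z k)))) with hS
  calc _ ≤ ∫⁻ _ω, ∫⁻ _ω', S ∂ν.law ∂ν.law := by
        refine lintegral_mono fun y => lintegral_mono fun y' => ?_
        exact le_iSup (fun p : Y × Y => ENNReal.ofReal (Real.exp (r * ∑ k, boolSign (σ k) *
          (residualProd H H p (z' k) - residualProd H H p (z k))))) (y, y')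
    _ = S := by simp

/-! ## Symmetrization -/

/-- Exchanges the two components at the indices where `σ` is false. -/
def swapBy {Z : Type*} {n : ℕ} (σ : Fin n → Bool) (w : Fin n → Z × Z) : Fin n → Z × Z :=
  fun k => if σ k then w k else (w k).swap

theorem measurePreserving_swapBy {Z : Type*} [MeasurableSpace Z] (P : Measure Z)
    [IsProbabilityMeasure P] {n : ℕ} (σ : Fin n → Bool) :
    MeasurePreserving (swapBy (Z := Z) σ) (Measure.pi fun _ => P.prod P)
      (Measure.pi fun _ => P.prod P) := by
  refine measurePreserving_pi (fun _ => P.prod P) (fun _ => P.prod P)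
    (f := fun k p => if σ k then p else p.swap) fun k => ?_
  cases hk : σ k
  · simpa using Measure.measurePreserving_swap (μ := P) (ν := P)
  · simpa [hk] using! MeasurePreserving.id (P.prod P)

theorem lintegral_pi_pi_eq {Z : Type*} [MeasurableSpace Z] (P : Measure Z)
    [IsProbabilityMeasure P] {n : ℕ} {f : (Fin n → Z) → (Fin n → Z) → ENNReal}
    (hf : Measurable (Function.uncurry f)) :
    ∫⁻ z, ∫⁻ z', f z z' ∂(Measure.pi fun _ : Fin n => P) ∂(Measure.pi fun _ : Fin n => P) =
      ∫⁻ w, f (fun k => (w k).1) (fun k => (w k).2) ∂(Measure.pi fun _ : Fin n => P.prod P) := by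
  have h := measurePreserving_arrowProdEquivProdArrow Z Z (Fin n) (fun _ => P) (fun _ => P)
  have h' := lintegral_prod (μ := Measure.pi fun _ : Fin n => P)
    (ν := Measure.pi fun _ : Fin n => P) (Function.uncurry f) hf.aemeasurable
  exact h'.symm.trans (h.lintegral_comp hf).symm

/-- Jensen's inequality for a ghost sample. -/
theorem ofReal_exp_deviation_le {Z : Type*} [MeasurableSpace Z] {P : Measure Z}
    [IsProbabilityMeasure P] {g : Z → ℝ} (hg : Integrable g P) {n : ℕ} (z : Fin n → Z) (r : ℝ) :
    ENNReal.ofReal (Real.exp (r * (n * ∫ a, g a ∂P - ∑ k, g (z k)))) ≤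
      ∫⁻ z' : Fin n → Z, ENNReal.ofReal (Real.exp (r * ∑ k, (g (z' k) - g (z k))))
        ∂(Measure.pi fun _ : Fin n => P) := by
  have hk : ∀ k : Fin n, Integrable (fun z' : Fin n → Z => g (z' k))
      (Measure.pi fun _ : Fin n => P) := fun k =>
    (measurePreserving_eval (fun _ : Fin n => P) k).integrable_comp_of_integrable hg
  have hk' : ∀ k : Fin n, ∫ z' : Fin n → Z, g (z' k) ∂(Measure.pi fun _ : Fin n => P) =
      ∫ a, g a ∂P := fun k => by
    have he := measurePreserving_eval (fun _ : Fin n => P) k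
    have hgm : AEStronglyMeasurable g (Measure.map (Function.eval k)
        (Measure.pi fun _ : Fin n => P)) := by
      rw [he.map_eq]
      exact hg.aestronglyMeasurable
    have := integral_map he.measurable.aemeasurable hgm
    rw [he.map_eq] at this
    exact this.symm
  have hsub : ∀ k : Fin n, Integrable (fun z' : Fin n → Z => g (z' k) - g (z k))
      (Measure.pi fun _ : Fin n => P) := fun k => (hk k).sub (integrable_const _)
  have hint : ∫ z' : Fin n → Z, r * ∑ k, (g (z' k) - g (z k))
      ∂(Measure.pi fun _ : Fin n => P) = r * (n * ∫ a, g a ∂P - ∑ k, g (z k)) := by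
    rw [integral_const_mul, integral_finsetSum _ fun k _ => hsub k]
    simp_rw [integral_sub (hk _) (integrable_const _), hk']
    simp
  rw [← hint]
  exact ofReal_exp_integral_le ((integrable_finsetSum _ fun k _ => hsub k).const_mul r)

/-- The supremum of the exponentials of the symmetrized process. -/
noncomputable def symExp {I Z : Type*} (g : I → Z → ℝ) {n : ℕ} (r : ℝ) (σ : Fin n → Bool)
    (z z' : Fin n → Z) : ENNReal :=
  ⨆ i, ENNReal.ofReal (Real.exp (r * ∑ k, boolSign (σ k) * (g i (z' k) - g i (z k))))

theorem measurable_symExp {I Z : Type*} [Countable I] [MeasurableSpace Z] {g : I → Z → ℝ}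
    (hg : ∀ i, Measurable (g i)) {n : ℕ} (r : ℝ) (σ : Fin n → Bool) :
    Measurable (Function.uncurry (symExp g r σ)) := by
  refine Measurable.iSup fun i => ENNReal.measurable_ofReal.comp (Real.measurable_exp.comp ?_)
  refine measurable_const.mul (Finset.measurable_fun_sum _ fun k _ => measurable_const.mul ?_)
  exact ((hg i).comp ((measurable_pi_apply k).comp measurable_snd)).sub
    ((hg i).comp ((measurable_pi_apply k).comp measurable_fst))

theorem measurable_symExp_fst_snd {I Z : Type*} [Countable I] [MeasurableSpace Z] {g : I → Z → ℝ}
    (hg : ∀ i, Measurable (g i)) {n : ℕ} (r : ℝ) (σ : Fin n → Bool) :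
    Measurable fun w : Fin n → Z × Z =>
      symExp g r σ (fun k => (w k).1) (fun k => (w k).2) := by
  unfold symExp
  refine Measurable.iSup fun i => ENNReal.measurable_ofReal.comp (Real.measurable_exp.comp ?_)
  refine measurable_const.mul (Finset.measurable_fun_sum _ fun k _ => measurable_const.mul ?_)
  exact ((hg i).comp (measurable_snd.comp (measurable_pi_apply k))).sub
    ((hg i).comp (measurable_fst.comp (measurable_pi_apply k)))

/-- Exchanging `z k` with `z' k` flips the sign of the `k`-th summand. -/
theorem symExp_swapBy {I Z : Type*} (g : I → Z → ℝ) {n : ℕ} (r : ℝ) (σ : Fin n → Bool)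
    (w : Fin n → Z × Z) :
    symExp g r (fun _ => true) (fun k => (swapBy σ w k).1) (fun k => (swapBy σ w k).2) =
      symExp g r σ (fun k => (w k).1) (fun k => (w k).2) := by
  unfold symExp
  congr 1
  ext i
  congr 3
  refine Finset.sum_congr rfl fun k _ => ?_
  cases h : σ k <;> simp [boolSign, swapBy, h]

/-- A class with a symmetrization bound has the same bound for the exponential moments of the
maximal deviation of the sample sums from their expectation. -/
theorem lintegral_iSup_exp_deviation_le {I Z : Type*} [Countable I] [MeasurableSpace Z]
    {g : I → Z → ℝ} (hg : ∀ i, Measurable (g i)) (hg1 : ∀ i z, |g i z| ≤ 1) {n : ℕ} {r : ℝ}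
    {B : ENNReal} (hB : SymBound g n r B) (P : Measure Z) [IsProbabilityMeasure P] :
    ∫⁻ z, ⨆ i, ENNReal.ofReal (Real.exp (r * (n * ∫ a, g i a ∂P - ∑ k, g i (z k))))
      ∂(Measure.pi fun _ : Fin n => P) ≤ B := by
  have hgi : ∀ i, Integrable (g i) P := fun i =>
    Integrable.of_bound (hg i).aestronglyMeasurable 1 (Eventually.of_forall fun z => hg1 i z)
  let Ψ : (Fin n → Bool) → (Fin n → Z × Z) → ENNReal := fun σ w =>
    symExp g r σ (fun k => (w k).1) (fun k => (w k).2)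
  have h1 : ∫⁻ z, ⨆ i, ENNReal.ofReal (Real.exp (r * (n * ∫ a, g i a ∂P - ∑ k, g i (z k))))
      ∂(Measure.pi fun _ : Fin n => P) ≤
      ∫⁻ z, ∫⁻ z', symExp g r (fun _ => true) z z' ∂(Measure.pi fun _ : Fin n => P)
        ∂(Measure.pi fun _ : Fin n => P) := by
    refine lintegral_mono fun z => iSup_le fun i => ?_
    exact (ofReal_exp_deviation_le (hgi i) z r).trans (lintegral_mono fun z' =>
      le_iSup_of_le i (le_of_eq (by simp [boolSign])))
  rw [lintegral_pi_pi_eq P (measurable_symExp hg r _)] at h1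
  refine h1.trans ?_
  have h2 : ∀ σ : Fin n → Bool, ∫⁻ w, Ψ (fun _ => true) w ∂(Measure.pi fun _ : Fin n => P.prod P) =
      ∫⁻ w, Ψ σ w ∂(Measure.pi fun _ : Fin n => P.prod P) := fun σ => by
    rw [← (measurePreserving_swapBy P σ).lintegral_comp (measurable_symExp_fst_snd hg r _)]
    exact lintegral_congr fun w => symExp_swapBy g r σ w
  -- By exchangeability all sign patterns have the same integral, so the one with all signs positive
  -- is the average over the `2 ^ n` patterns, which is bounded pointwise.
  have h3 : (2 : ENNReal) ^ n * ∫⁻ w, Ψ (fun _ => true) w ∂(Measure.pi fun _ : Fin n => P.prod P) ≤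
      2 ^ n * B := by
    calc _ = ∑ σ : Fin n → Bool, ∫⁻ w, Ψ σ w ∂(Measure.pi fun _ : Fin n => P.prod P) := by
          simp_rw [← h2]
          simp
      _ = ∫⁻ w, ∑ σ : Fin n → Bool, Ψ σ w ∂(Measure.pi fun _ : Fin n => P.prod P) :=
          (lintegral_finsetSum _ fun σ _ => measurable_symExp_fst_snd hg r σ).symm
      _ ≤ ∫⁻ _w, 2 ^ n * B ∂(Measure.pi fun _ : Fin n => P.prod P) :=
          lintegral_mono fun w => hB _ _
      _ = _ := by simp
  exact (ENNReal.mul_le_mul_iff_right (by simp) (by simp)).1 h3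

/-- The tail of the maximal deviation. -/
theorem measure_exists_deviation_ge_le {I Z : Type*} [Countable I] [MeasurableSpace Z]
    {g : I → Z → ℝ} (hg : ∀ i, Measurable (g i)) (hg1 : ∀ i z, |g i z| ≤ 1) {n : ℕ} {r : ℝ}
    {b : ℝ} (hB : SymBound g n r (ENNReal.ofReal b)) (P : Measure Z) [IsProbabilityMeasure P]
    (s : ℝ) :
    (Measure.pi fun _ : Fin n => P)
      {z | ∃ i, s ≤ r * (n * ∫ a, g i a ∂P - ∑ k, g i (z k))} ≤
        ENNReal.ofReal (b * Real.exp (-s)) := by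
  have hm : Measurable fun z : Fin n → Z =>
      ⨆ i, ENNReal.ofReal (Real.exp (r * (n * ∫ a, g i a ∂P - ∑ k, g i (z k)))) := by
    refine Measurable.iSup fun i => ENNReal.measurable_ofReal.comp (Real.measurable_exp.comp ?_)
    have := hg i
    fun_prop
  have h1 := mul_meas_ge_le_lintegral (μ := Measure.pi fun _ : Fin n => P) hm
    (ENNReal.ofReal (Real.exp s))
  have h2 := h1.trans (lintegral_iSup_exp_deviation_le hg hg1 hB P)
  have h3 : {z : Fin n → Z | ∃ i, s ≤ r * (n * ∫ a, g i a ∂P - ∑ k, g i (z k))} ⊆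
      {z | ENNReal.ofReal (Real.exp s) ≤
        ⨆ i, ENNReal.ofReal (Real.exp (r * (n * ∫ a, g i a ∂P - ∑ k, g i (z k))))} := by
    rintro z ⟨i, hi⟩
    exact (ENNReal.ofReal_le_ofReal (Real.exp_le_exp.2 hi)).trans (le_iSup (fun i =>
      ENNReal.ofReal (Real.exp (r * (n * ∫ a, g i a ∂P - ∑ k, g i (z k))))) i)
  have h4 := (mul_le_mul_right (measure_mono h3) (ENNReal.ofReal (Real.exp s))).trans h2
  rw [ENNReal.ofReal_mul' (Real.exp_pos _).le, Real.exp_neg,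
    ENNReal.ofReal_inv_of_pos (Real.exp_pos _), ← div_eq_mul_inv, ENNReal.le_div_iff_mul_le
      (Or.inl (by simp [Real.exp_pos])) (Or.inl ENNReal.ofReal_ne_top), mul_comm]
  exact h4

/-! ## Learning by approximate minimization of the empirical loss -/

theorem loss_nonneg {X : Type*} (h : X → unitInterval) (z : Sample X) : 0 ≤ loss h z := sq_nonneg _

theorem loss_le_one {X : Type*} (h : X → unitInterval) (z : Sample X) : loss h z ≤ 1 := by
  have h1 := (h z.1).2
  have h2 := z.2.2
  exact (sq_le_one_iff_abs_le_one _).2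
    (abs_le.2 ⟨by linarith [h1.1, h2.2], by linarith [h1.2, h2.1]⟩)

theorem abs_loss_sub_le {X : Type*} (h h' : X → unitInterval) (z : Sample X) :
    |loss h z - loss h' z| ≤ 2 * |(h z.1 : ℝ) - h' z.1| := by
  have h1 := (h z.1).2
  have h2 := z.2.2
  have h3 := (h' z.1).2
  have e : loss h z - loss h' z = ((h z.1 : ℝ) + h' z.1 - 2 * z.2) * (h z.1 - h' z.1) := by
    simp only [loss]
    ring
  rw [e, abs_mul]
  refine mul_le_mul_of_nonneg_right (abs_le.2 ⟨?_, ?_⟩) (abs_nonneg _) <;>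
    linarith [h1.1, h1.2, h2.1, h2.2, h3.1, h3.2]

theorem measurable_loss {X : Type*} [MeasurableSpace X] {h : X → unitInterval}
    (hh : Measurable h) : Measurable (loss h) :=
  ((measurable_subtype_coe.comp (hh.comp measurable_fst)).sub
    (measurable_subtype_coe.comp measurable_snd)).pow_const 2

theorem integrable_loss {X : Type*} [MeasurableSpace X] {h : X → unitInterval}
    (hh : Measurable h) (P : Measure (Sample X)) [IsProbabilityMeasure P] :
    Integrable (loss h) P :=
  Integrable.of_bound (measurable_loss hh).aestronglyMeasurable 1 (Eventually.of_forall fun z => by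
    rw [Real.norm_eq_abs, abs_of_nonneg (loss_nonneg h z)]
    exact loss_le_one h z)

theorem SymBound.comp {I J Z : Type*} {g : I → Z → ℝ} {n : ℕ} {r : ℝ} {B : ENNReal}
    (h : SymBound g n r B) (φ : J → I) : SymBound (fun j => g (φ j)) n r B := fun z z' =>
  (Finset.sum_le_sum fun σ _ => iSup_comp_le (fun i => ENNReal.ofReal
    (Real.exp (r * ∑ k, boolSign (σ k) * (g i (z' k) - g i (z k))))) φ).trans (h z z')

/-- The parameters `φ j` approximate every hypothesis, in expected loss and in the loss at
finitely many samples. -/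
def LossDense {X I J : Type*} [MeasurableSpace X] (G : HypClass X I) (φ : J → I) : Prop :=
  ∀ (P : Measure (Sample X)), IsProbabilityMeasure P → ∀ (n : ℕ) (z : Fin n → Sample X) (i : I)
    (η : ℝ), 0 < η → ∃ j, |expLoss P (fun x => G x (φ j)) - expLoss P (fun x => G x i)| ≤ η ∧
      ∀ k, |loss (fun x => G x (φ j)) (z k) - loss (fun x => G x i) (z k)| ≤ η

theorem exists_empirical_minimizer {X I : Type*} [Nonempty I] (G : HypClass X I) {η : ℝ}
    (hη : 0 < η) (n : ℕ) (z : Fin n → Sample X) :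
    ∃ i, ∀ i', ∑ k, loss (fun x => G x i) (z k) ≤ ∑ k, loss (fun x => G x i') (z k) + η := by
  obtain ⟨i, hi⟩ := exists_lt_of_ciInf_lt
    (lt_add_of_pos_right (⨅ i, ∑ k, loss (fun x => G x i) (z k)) hη)
  refine ⟨i, fun i' => hi.le.trans (add_le_add_left (ciInf_le ⟨0, ?_⟩ i') _)⟩
  rintro _ ⟨i, rfl⟩
  exact Finset.sum_nonneg fun k _ => loss_nonneg _ _

theorem LossDense.exists_deviation_ge {X I J : Type*} [MeasurableSpace X] {G : HypClass X I}
    {φ : J → I} (hφ : LossDense G φ) (P : Measure (Sample X)) [IsProbabilityMeasure P] {n : ℕ}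
    (z : Fin n → Sample X) (i : I) {η : ℝ} (hη : 0 < η) :
    ∃ j, |(n * expLoss P (fun x => G x (φ j)) - ∑ k, loss (fun x => G x (φ j)) (z k)) -
      (n * expLoss P (fun x => G x i) - ∑ k, loss (fun x => G x i) (z k))| ≤ n * (2 * η) := by
  obtain ⟨j, hj1, hj2⟩ := hφ P inferInstance n z i η hη
  refine ⟨j, ?_⟩
  have h1 : |∑ k, loss (fun x => G x (φ j)) (z k) - ∑ k, loss (fun x => G x i) (z k)| ≤ n * η := by
    rw [← Finset.sum_sub_distrib]
    refine (Finset.abs_sum_le_sum_abs _ _).trans ((Finset.sum_le_sum fun k _ => hj2 k).trans ?_)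
    simp
  have h2 : |(n : ℝ) * (expLoss P (fun x => G x (φ j)) - expLoss P (fun x => G x i))| ≤ n * η := by
    rw [abs_mul, Nat.abs_cast]
    exact mul_le_mul_of_nonneg_left hj1 (Nat.cast_nonneg n)
  rw [abs_le] at h1 h2 ⊢
  constructor <;> linarith [h1.1, h1.2, h2.1, h2.2]

/-- The learner is any choice of approximate empirical minimizer and need not be measurable: failure
forces a large deviation at some member of the countable family `φ`. The bound for `r` controls
hypotheses whose empirical loss is too small, the one for `-r` those whose empirical loss is too
large; the union of the two gives the factor 2. -/
theorem agnosticPACLearnable_of_symBound {X I J : Type*} [MeasurableSpace X] [Nonempty I]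
    [Countable J] {G : HypClass X I} {φ : J → I} (hmeas : ∀ j, Measurable fun x => G x (φ j))
    (hφ : LossDense G φ) {ε δ : ℝ} (hε : 0 < ε) {N : ℕ} (hN : 1 ≤ N)
    (hB : ∀ n ≥ N, ∃ r b : ℝ, 0 < r ∧ 0 ≤ b ∧
      SymBound (fun i => loss fun x => G x i) n r (ENNReal.ofReal b) ∧
      SymBound (fun i => loss fun x => G x i) n (-r) (ENNReal.ofReal b) ∧
      2 * b * Real.exp (-(r * (n * (49 / 100 * ε)))) ≤ δ) :
    AgnosticPACLearnable G ε δ N := by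
  have hη : 0 < ε / 400 := by positivity
  choose A hA using exists_empirical_minimizer G hη
  refine ⟨A, fun n hn P hP => ?_⟩
  obtain ⟨r, b, hr, hb, hB₁, hB₂, hδ⟩ := hB n hn
  have hn1 : (1 : ℝ) ≤ n := by exact_mod_cast hN.trans hn
  obtain ⟨i₀, hi₀⟩ : ∃ i, expLoss P (fun x => G x i) < bestExpLoss P G + ε / 400 :=
    exists_lt_of_ciInf_lt (lt_add_of_pos_right _ hη)
  have htail := fun r hB => measure_exists_deviation_ge_le (I := J) (r := r) (b := b)
    (g := fun j => loss fun x => G x (φ j)) (n := n) (fun j => measurable_loss (hmeas j))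
    (fun j z => by rw [abs_of_nonneg (loss_nonneg _ z)]; exact loss_le_one _ z) hB P
  have h₁ := htail r (hB₁.comp φ) (|r| * (n * (49 / 100 * ε)))
  have h₂ := htail (-r) (hB₂.comp φ) (|r| * (n * (49 / 100 * ε)))
  rw [abs_of_pos hr] at h₁ h₂
  refine (measure_mono ?_).trans ((measure_union_le _ _).trans ((add_le_add h₁ h₂).trans ?_))
  · intro z hz
    have hz' : bestExpLoss P G + ε < expLoss P (fun x => G x (A n z)) := hz
    have hAz := hA n z i₀
    obtain ⟨j₁, hj₁⟩ := hφ.exists_deviation_ge P z (A n z) hη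
    obtain ⟨j₂, hj₂⟩ := hφ.exists_deviation_ge P z i₀ hη
    rw [abs_le] at hj₁ hj₂
    -- Per sample, the excess ε loses ε/400 to the choice of `i₀`, at most ε/400 to inexact
    -- minimization, and 2ε/400 to each of `j₁` and `j₂`. The remaining 394ε/400 exceeds 2 ·
    -- 49ε/100.
    have hcase : n * (49 / 100 * ε) ≤
          n * expLoss P (fun x => G x (φ j₁)) - ∑ k, loss (fun x => G x (φ j₁)) (z k) ∨
        n * (49 / 100 * ε) ≤
          -(n * expLoss P (fun x => G x (φ j₂)) - ∑ k, loss (fun x => G x (φ j₂)) (z k)) := by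
      by_contra! hcon
      have h3 : (n : ℝ) * (ε - ε / 400) ≤
          n * (expLoss P (fun x => G x (A n z)) - expLoss P (fun x => G x i₀)) :=
        mul_le_mul_of_nonneg_left (by linarith) (by linarith)
      have h4 : ε / 400 ≤ n * (ε / 400) := le_mul_of_one_le_left hη.le hn1
      have h5 : (0 : ℝ) < n * ε := by positivity
      linarith [hj₁.1, hj₁.2, hj₂.1, hj₂.2, hcon.1, hcon.2]
    rcases hcase with h | h
    · exact Or.inl ⟨j₁, mul_le_mul_of_nonneg_left h hr.le⟩
    · refine Or.inr ⟨j₂, ?_⟩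
      rw [neg_mul, ← mul_neg]
      exact mul_le_mul_of_nonneg_left h hr.le
  · rw [← ENNReal.ofReal_add (by positivity) (by positivity)]
    exact ENNReal.ofReal_le_ofReal (by linarith)

/-- Learnability from covers of size `M n` at scale `4 ε / 50`. -/
theorem agnosticPACLearnable_of_card {X I J : Type*} [MeasurableSpace X] [Nonempty I]
    [Countable J] {G : HypClass X I} {φ : J → I} (hmeas : ∀ j, Measurable fun x => G x (φ j))
    (hφ : LossDense G φ) {ε δ : ℝ} (hε : 0 < ε) {N : ℕ} (hN : 1 ≤ N) {M : ℕ → ℕ}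
    (hB : ∀ n ≥ N, ∀ r : ℝ, SymBound (fun i => loss fun x => G x i) n r (ENNReal.ofReal
      ((M n : ℝ) ^ 2 * Real.exp (4 * (4 * (ε / 50)) * |r| * n + 2 * r ^ 2 * n))))
    (hM : ∀ n ≥ N, 2 * (M n : ℝ) ^ 2 * Real.exp (-(n * ε ^ 2 / 300)) ≤ δ) :
    AgnosticPACLearnable G ε δ N := by
  refine agnosticPACLearnable_of_symBound hmeas hφ hε hN fun n hn => ?_
  -- The exponent per sample is 2r² - (49/100 - 16/50) ε r, and 17ε/400 minimizes it. The minimum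
  -- -(17/100)² ε²/8 is below -ε²/300.
  have hr : 0 < 17 / 400 * ε := by positivity
  refine ⟨17 / 400 * ε, _, hr, ?_, hB n hn _, ?_, ?_⟩
  · positivity
  · have := hB n hn (-(17 / 400 * ε))
    rwa [abs_neg, neg_sq] at this
  · rw [abs_of_pos hr]
    refine le_trans ?_ (hM n hn)
    have h : (0 : ℝ) ≤ n * ε ^ 2 := by positivity
    calc _ = 2 * (M n : ℝ) ^ 2 * Real.exp (4 * (4 * (ε / 50)) * (17 / 400 * ε) * n +
          2 * (17 / 400 * ε) ^ 2 * n + -(17 / 400 * ε * (n * (49 / 100 * ε)))) := by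
          rw [Real.exp_add _ (-_)]
          ring
      _ ≤ _ := by
          refine mul_le_mul_of_nonneg_left (Real.exp_le_exp.2 ?_) (by positivity)
          linarith

/-- A class all of whose hypotheses are within `ε / 2` of each other is learnable from any number
of samples. -/
theorem agnosticPACLearnable_of_abs_sub_le {X I : Type*} [MeasurableSpace X] [Nonempty I]
    {G : HypClass X I} (hmeas : ∀ i, Measurable fun x => G x i) {ε : ℝ} (δ : ℝ)
    (hG : ∀ x i i', |(G x i : ℝ) - G x i'| ≤ ε / 2) (N : ℕ) : AgnosticPACLearnable G ε δ N := by
  refine ⟨fun _ _ => Classical.arbitrary I, fun n _ P hP => ?_⟩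
  rw [show {z : Fin n → Sample X | bestExpLoss P G + ε <
    expLoss P (fun x => G x (Classical.arbitrary I))} = ∅ from ?_]
  · simp
  rw [Set.eq_empty_iff_forall_notMem]
  intro z hz
  have hz' : bestExpLoss P G + ε < expLoss P (fun x => G x (Classical.arbitrary I)) := hz
  have : expLoss P (fun x => G x (Classical.arbitrary I)) - ε ≤ bestExpLoss P G := by
    refine le_ciInf fun i => ?_
    have h1 : expLoss P (fun x => G x (Classical.arbitrary I)) ≤
        ∫ z, (loss (fun x => G x i) z + ε) ∂P := by
      refine integral_mono (integrable_loss (hmeas _) P)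
        ((integrable_loss (hmeas i) P).add (integrable_const _)) fun z => ?_
      have h2 := (le_abs_self _).trans (abs_loss_sub_le (fun x => G x (Classical.arbitrary I))
        (fun x => G x i) z)
      have h3 := hG z.1 (Classical.arbitrary I) i
      dsimp only at h2 ⊢
      linarith
    rw [integral_add (integrable_loss (hmeas i) P) (integrable_const _)] at h1
    simp only [integral_const, probReal_univ, one_smul] at h1
    have h4 : expLoss P (fun x => G x i) = ∫ z, loss (fun x => G x i) z ∂P := rfl
    linarith
  linarith

/-! ## Countable approximation -/

theorem exists_loss_close_of_tendsto {X : Type*} [MeasurableSpace X] {u : ℕ → X → unitInterval}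
    {h : X → unitInterval} (hu : ∀ m, Measurable (u m))
    (hlim : ∀ x, Tendsto (fun m => u m x) atTop (𝓝 (h x))) (P : Measure (Sample X))
    [IsProbabilityMeasure P] {n : ℕ} (z : Fin n → Sample X) {η : ℝ} (hη : 0 < η) :
    ∃ m, |expLoss P (u m) - expLoss P h| ≤ η ∧ ∀ k, |loss (u m) (z k) - loss h (z k)| ≤ η := by
  have hl : ∀ z, Tendsto (fun m => loss (u m) z) atTop (𝓝 (loss h z)) := fun z =>
    (((continuous_subtype_val.tendsto _).comp (hlim z.1)).sub_const _).pow 2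
  have hE : Tendsto (fun m => expLoss P (u m)) atTop (𝓝 (expLoss P h)) := by
    refine tendsto_integral_of_dominated_convergence (fun _ => 1)
      (fun m => (measurable_loss (hu m)).aestronglyMeasurable) (integrable_const _)
      (fun m => Eventually.of_forall fun z => ?_) (Eventually.of_forall hl)
    rw [Real.norm_eq_abs, abs_of_nonneg (loss_nonneg _ z)]
    exact loss_le_one _ z
  have hclose : ∀ {a : ℕ → ℝ} {b : ℝ}, Tendsto a atTop (𝓝 b) → ∀ᶠ m in atTop, |a m - b| ≤ η :=
    fun ha => (Metric.tendsto_nhds.1 ha η hη).mono fun m hm => by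
      rw [Real.dist_eq] at hm
      exact hm.le
  exact ((hclose hE).and (eventually_all.2 fun k => hclose (hl (z k)))).exists

theorem lossDense_of_forall_tendsto {X Y : Type*} [MeasurableSpace X] {H : HypClass X Y}
    (hH : ∀ y, Measurable fun x => H x y) {D : Set Y}
    (hD : ∀ y, ∃ u : ℕ → Y, (∀ k, u k ∈ D) ∧
      ∀ x, Tendsto (fun k => H x (u k)) atTop (𝓝 (H x y))) :
    LossDense H (Subtype.val : D → Y) := by
  intro P hP n z y η hη
  obtain ⟨u, huD, hu⟩ := hD y
  obtain ⟨m, hm⟩ := exists_loss_close_of_tendsto (fun m => hH (u m)) hu P z hη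
  exact ⟨⟨u m, huD m⟩, hm⟩

/-! ### Approximation of a mixture by averages -/

theorem integrable_of_measurable_of_abs_le {Ω : Type*} [MeasurableSpace Ω] {Q : Measure Ω}
    [IsFiniteMeasure Q] {f : Ω → ℝ} (hf : Measurable f) {c : ℝ} (hc : ∀ x, |f x| ≤ c) :
    Integrable f Q :=
  Integrable.of_bound hf.aestronglyMeasurable c (Eventually.of_forall hc)

/-- Some member of a family is negatively correlated with a given function, after centering. -/
theorem exists_integral_mul_sub_le_zero {X Y : Type*} [MeasurableSpace X] [MeasurableSpace Y]
    {H : X → Y → ℝ} (hH : Measurable (Function.uncurry H)) (hH1 : ∀ x y, H x y ∈ Set.Icc (0 : ℝ) 1)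
    (ν : Measure Y) [IsProbabilityMeasure ν] (Q : Measure X) [IsFiniteMeasure Q] {ψ : X → ℝ}
    (hψ : Measurable ψ) {c : ℝ} (hc : ∀ x, |ψ x| ≤ c) :
    ∃ y, ∫ x, ψ x * (H x y - ∫ y', H x y' ∂ν) ∂Q ≤ 0 := by
  have hf : Measurable fun x => ∫ y', H x y' ∂ν :=
    (StronglyMeasurable.integral_prod_right hH.stronglyMeasurable).measurable
  have hHi : ∀ x, Integrable (H x) ν := fun x =>
    integrable_of_measurable_of_abs_le (c := 1) (hH.comp measurable_prodMk_left) fun y => by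
      rw [abs_of_nonneg (hH1 x y).1]
      exact (hH1 x y).2
  have hf0 : ∀ x, 0 ≤ ∫ y', H x y' ∂ν := fun x => integral_nonneg fun y => (hH1 x y).1
  have hf1 : ∀ x, ∫ y', H x y' ∂ν ≤ 1 := fun x => by
    simpa using integral_mono (hHi x) (integrable_const 1) fun y => (hH1 x y).2
  have hint : Integrable (Function.uncurry fun x y => ψ x * (H x y - ∫ y', H x y' ∂ν))
      (Q.prod ν) := by
    refine integrable_of_measurable_of_abs_le (c := c) ?_ fun p => ?_
    · exact (hψ.comp measurable_fst).mul (hH.sub (hf.comp measurable_fst))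
    · simp only [Function.uncurry, abs_mul]
      refine (mul_le_mul (hc p.1) (abs_le.2 ⟨?_, ?_⟩) (abs_nonneg _)
        ((abs_nonneg _).trans (hc p.1))).trans (mul_one c).le
      · linarith [(hH1 p.1 p.2).1, hf1 p.1]
      · linarith [(hH1 p.1 p.2).2, hf0 p.1]
  -- By Fubini the `ν`-average over `y` of these correlations is zero, so some `y` does no worse.
  obtain ⟨y, hy⟩ := exists_le_integral hint.integral_prod_right
  refine ⟨y, hy.trans (le_of_eq ?_)⟩
  change ∫ y, ∫ x, ψ x * (H x y - ∫ y', H x y' ∂ν) ∂Q ∂ν = 0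
  rw [← integral_integral_swap hint]
  have : ∀ x, ∫ y, ψ x * (H x y - ∫ y', H x y' ∂ν) ∂ν = 0 := fun x => by
    rw [integral_const_mul, integral_sub (hHi x) (integrable_const _)]
    simp
  simp [this]

/-- Averages of `m` members of a family approximate a mixture in mean square, with error `1 / m`
times the total mass. -/
theorem exists_integral_sq_sum_sub_le {X Y : Type*} [MeasurableSpace X] [MeasurableSpace Y]
    {H : X → Y → ℝ} (hH : Measurable (Function.uncurry H)) (hH1 : ∀ x y, H x y ∈ Set.Icc (0 : ℝ) 1)
    (ν : Measure Y) [IsProbabilityMeasure ν] (Q : Measure X) [IsFiniteMeasure Q] (m : ℕ) :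
    ∃ y : Fin m → Y, ∫ x, (∑ k, H x (y k) - m * ∫ y', H x y' ∂ν) ^ 2 ∂Q ≤
      m * Q.real Set.univ := by
  have hf : Measurable fun x => ∫ y', H x y' ∂ν :=
    (StronglyMeasurable.integral_prod_right hH.stronglyMeasurable).measurable
  have hHy : ∀ y, Measurable fun x => H x y := fun y => hH.comp measurable_prodMk_right
  have hHi : ∀ x, Integrable (H x) ν := fun x =>
    integrable_of_measurable_of_abs_le (c := 1) (hH.comp measurable_prodMk_left) fun y => by
      rw [abs_of_nonneg (hH1 x y).1]
      exact (hH1 x y).2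
  have hf0 : ∀ x, 0 ≤ ∫ y', H x y' ∂ν := fun x => integral_nonneg fun y => (hH1 x y).1
  have hf1 : ∀ x, ∫ y', H x y' ∂ν ≤ 1 := fun x => by
    simpa using integral_mono (hHi x) (integrable_const 1) fun y => (hH1 x y).2
  have hd1 : ∀ x y, |H x y - ∫ y', H x y' ∂ν| ≤ 1 := fun x y =>
    abs_le.2 ⟨by linarith [(hH1 x y).1, hf1 x], by linarith [(hH1 x y).2, hf0 x]⟩
  induction m with
  | zero => exact ⟨Fin.elim0, by simp⟩
  | succ m ih =>
    obtain ⟨y, hy⟩ := ih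
    set ψ : X → ℝ := fun x => ∑ k, H x (y k) - m * ∫ y', H x y' ∂ν with hψ
    have hψm : Measurable ψ :=
      (Finset.measurable_fun_sum _ fun k _ => hHy (y k)).sub (hf.const_mul _)
    have hψm1 : ∀ x, |ψ x| ≤ m := fun x => by
      have : ψ x = ∑ k, (H x (y k) - ∫ y', H x y' ∂ν) := by simp [hψ, Finset.sum_sub_distrib]
      rw [this]
      refine (Finset.abs_sum_le_sum_abs _ _).trans
        ((Finset.sum_le_sum fun k _ => hd1 x (y k)).trans ?_)
      simp
    -- The next member is chosen greedily: its cross term with the accumulated error `ψ` is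
    -- nonpositive, so the squared error grows by at most the total mass.
    obtain ⟨y₀, hy₀⟩ := exists_integral_mul_sub_le_zero hH hH1 ν Q hψm hψm1
    have hdm : Measurable fun x => H x y₀ - ∫ y', H x y' ∂ν := (hHy y₀).sub hf
    refine ⟨Fin.cons y₀ y, ?_⟩
    have e : ∀ x, (∑ k, H x ((Fin.cons y₀ y : Fin (m + 1) → Y) k) -
        ((m + 1 : ℕ) : ℝ) * ∫ y', H x y' ∂ν) ^ 2 =
        (ψ x ^ 2 + 2 * (ψ x * (H x y₀ - ∫ y', H x y' ∂ν))) +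
          (H x y₀ - ∫ y', H x y' ∂ν) ^ 2 := fun x => by
      rw [Fin.sum_univ_succ]
      simp only [Fin.cons_zero, Fin.cons_succ, hψ]
      push_cast
      ring
    have i1 : Integrable (fun x => ψ x ^ 2) Q :=
      integrable_of_measurable_of_abs_le (c := (m : ℝ) ^ 2) (hψm.pow_const 2) fun x => by
        rw [abs_pow]
        exact pow_le_pow_left₀ (abs_nonneg _) (hψm1 x) 2
    have i2 : Integrable (fun x => 2 * (ψ x * (H x y₀ - ∫ y', H x y' ∂ν))) Q :=
      (integrable_of_measurable_of_abs_le (c := (m : ℝ)) (hψm.mul hdm) fun x => by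
        rw [Pi.mul_apply, abs_mul]
        exact (mul_le_mul (hψm1 x) (hd1 x y₀) (abs_nonneg _) (Nat.cast_nonneg _)).trans
          (mul_one _).le).const_mul 2
    have hsq : ∀ x, |(H x y₀ - ∫ y', H x y' ∂ν) ^ 2| ≤ 1 := fun x => by
      rw [abs_pow]
      exact pow_le_one₀ (abs_nonneg _) (hd1 x y₀)
    have i3 : Integrable (fun x => (H x y₀ - ∫ y', H x y' ∂ν) ^ 2) Q :=
      integrable_of_measurable_of_abs_le (hdm.pow_const 2) hsq
    simp_rw [e]
    have e1 := integral_add (i1.add i2) i3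
    have e2 := integral_add i1 i2
    simp only [Pi.add_apply] at e1
    rw [e1, e2, integral_const_mul]
    have h3 : ∫ x, (H x y₀ - ∫ y', H x y' ∂ν) ^ 2 ∂Q ≤ Q.real Set.univ := by
      simpa using integral_mono i3 (integrable_const (1 : ℝ))
        fun x => (le_abs_self _).trans (hsq x)
    push_cast
    linarith

theorem exists_average_close {X Y : Type*} [MeasurableSpace X] [MeasurableSpace Y]
    {H : X → Y → ℝ} (hH : Measurable (Function.uncurry H)) (hH1 : ∀ x y, H x y ∈ Set.Icc (0 : ℝ) 1)
    (ν : Measure Y) [IsProbabilityMeasure ν] (Q : Measure X) [IsFiniteMeasure Q] {η : ℝ}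
    (hη : 0 < η) :
    ∃ (m : ℕ) (y : Fin (m + 1) → Y),
      ∫ x, ((∑ k, H x (y k)) / (m + 1 : ℕ) - ∫ y', H x y' ∂ν) ^ 2 ∂Q ≤ η := by
  obtain ⟨m, hm⟩ := exists_nat_gt (Q.real Set.univ / η)
  obtain ⟨y, hy⟩ := exists_integral_sq_sum_sub_le hH hH1 ν Q (m + 1)
  refine ⟨m, y, ?_⟩
  have hm1 : (0 : ℝ) < (m + 1 : ℕ) := by positivity
  have e : ∀ x, ((∑ k, H x (y k)) / (m + 1 : ℕ) - ∫ y', H x y' ∂ν) ^ 2 =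
      (((m + 1 : ℕ) : ℝ) ^ 2)⁻¹ * (∑ k, H x (y k) - (m + 1 : ℕ) * ∫ y', H x y' ∂ν) ^ 2 := fun x => by
    field_simp
  simp_rw [e]
  rw [integral_const_mul, inv_mul_le_iff₀ (by positivity)]
  refine hy.trans ?_
  rw [div_lt_iff₀ hη] at hm
  rw [pow_two, mul_assoc]
  refine mul_le_mul_of_nonneg_left ?_ hm1.le
  push_cast
  linarith

/-! ### The distribution class -/

/-- The uniform distribution on a finite sequence of parameters. -/
noncomputable def empiricalDistribution {X Y : Type*} (H : HypClass X Y) {m : ℕ}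
    (y : Fin (m + 1) → Y) : CompatDistribution H where
  -- The largest σ-algebra makes every function on `Y` measurable; it is harmless for a law carried
  -- by finitely many points.
  sigma := ⊤
  law := @Measure.map _ _ _ ⊤ y (PMF.uniformOfFintype (Fin (m + 1))).toMeasure
  isProb := by
    let _ : MeasurableSpace Y := ⊤
    exact Measure.isProbabilityMeasure_map (measurable_of_finite y).aemeasurable
  measurable := fun x => measurable_from_top

theorem distributionClass_empiricalDistribution {X Y : Type*} (H : HypClass X Y) {m : ℕ}
    (y : Fin (m + 1) → Y) (x : X) :
    (distributionClass H x (empiricalDistribution H y) : ℝ) =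
      (∑ k, (H x (y k) : ℝ)) / (m + 1 : ℕ) := by
  let _ : MeasurableSpace Y := ⊤
  have h : (distributionClass H x (empiricalDistribution H y) : ℝ) =
      ∫ a, (H x a : ℝ) ∂(Measure.map y (PMF.uniformOfFintype (Fin (m + 1))).toMeasure) := rfl
  have hm : Measurable fun a => (H x a : ℝ) := measurable_from_top
  rw [h, integral_map (measurable_of_finite y).aemeasurable hm.aestronglyMeasurable,
    PMF.integral_eq_sum, Finset.sum_div]
  refine Finset.sum_congr rfl fun k _ => ?_
  simp only [PMF.uniformOfFintype_apply, Fintype.card_fin, ENNReal.toReal_inv,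
    ENNReal.toReal_natCast, smul_eq_mul, div_eq_inv_mul]

theorem IsJointlyMeasurable.measurable_uncurry {X Y : Type*} [MeasurableSpace X]
    {H : HypClass X Y} (hH : IsJointlyMeasurable H) (ν : CompatDistribution H) :
    @Measurable (X × Y) ℝ (@Prod.instMeasurableSpace X Y _ ν.sigma) _
      (Function.uncurry fun x y => (H x y : ℝ)) := by
  have hle : paramSigma H ≤ ν.sigma := iSup_le fun x => (ν.measurable x).comap_le
  have h : @Measurable (X × Y) unitInterval (@Prod.instMeasurableSpace X Y _ ν.sigma) _
      fun p => H p.1 p.2 :=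
    Measurable.mono hH (sup_le_sup le_rfl (MeasurableSpace.comap_mono hle)) le_rfl
  exact measurable_subtype_coe.comp h

theorem IsJointlyMeasurable.measurable_distributionClass {X Y : Type*} [MeasurableSpace X]
    {H : HypClass X Y} (hH : IsJointlyMeasurable H) (ν : CompatDistribution H) :
    Measurable fun x => distributionClass H x ν := by
  let _ := ν.sigma
  have := ν.isProb
  exact ((StronglyMeasurable.integral_prod_right (ν := ν.law)
    (hH.measurable_uncurry ν).stronglyMeasurable).measurable).subtype_mk

theorem IsJointlyMeasurable.exists_empiricalDistribution_close {X Y : Type*} [MeasurableSpace X]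
    {H : HypClass X Y} (hH : IsJointlyMeasurable H) (ν : CompatDistribution H)
    (P : Measure (Sample X)) [IsProbabilityMeasure P] {n : ℕ} (z : Fin n → Sample X) {η : ℝ}
    (hη : 0 < η) :
    ∃ (m : ℕ) (y : Fin (m + 1) → Y),
      |expLoss P (fun x => distributionClass H x (empiricalDistribution H y)) -
        expLoss P (fun x => distributionClass H x ν)| ≤ η ∧
      ∀ k, |loss (fun x => distributionClass H x (empiricalDistribution H y)) (z k) -
        loss (fun x => distributionClass H x ν) (z k)| ≤ η := by
  let _ := ν.sigma
  have := ν.isProb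
  -- One finite measure dominates both the marginal of `P` and the point masses at the samples, so a
  -- single mean-square approximation controls the expected loss and the sample losses.
  let Q : Measure X := P.map Prod.fst + ∑ k, Measure.dirac (z k).1
  have : IsProbabilityMeasure (P.map Prod.fst) :=
    Measure.isProbabilityMeasure_map measurable_fst.aemeasurable
  have hPQ : P.map Prod.fst ≤ Q := Measure.le_add_right le_rfl
  have hzQ : ∀ k, Measure.dirac (z k).1 ≤ Q := fun k =>
    (Finset.single_le_sum (f := fun k => Measure.dirac (z k).1) (fun _ _ => Measure.zero_le _)
      (Finset.mem_univ k)).trans (Measure.le_add_left le_rfl)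
  obtain ⟨m, y, hy⟩ := exists_average_close (hH.measurable_uncurry ν) (fun x y => (H x y).2)
    ν.law Q (η := (η / 2) ^ 2) (by positivity)
  refine ⟨m, y, ?_⟩
  set a : X → unitInterval := fun x => distributionClass H x (empiricalDistribution H y) with ha
  set b : X → unitInterval := fun x => distributionClass H x ν with hb
  have ham : Measurable a := hH.measurable_distributionClass _
  have hbm : Measurable b := hH.measurable_distributionClass _
  have hdm : Measurable fun x => (a x : ℝ) - b x :=
    (measurable_subtype_coe.comp ham).sub (measurable_subtype_coe.comp hbm)
  have hd1 : ∀ x, |(a x : ℝ) - b x| ≤ 1 := fun x =>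
    abs_le.2 ⟨by linarith [(a x).2.1, (b x).2.2], by linarith [(a x).2.2, (b x).2.1]⟩
  have hi2 : Integrable (fun x => ((a x : ℝ) - b x) ^ 2) Q :=
    integrable_of_measurable_of_abs_le (c := 1) (hdm.pow_const 2) fun x => by
      rw [abs_pow]
      exact pow_le_one₀ (abs_nonneg _) (hd1 x)
  have hy' : ∫ x, ((a x : ℝ) - b x) ^ 2 ∂Q ≤ (η / 2) ^ 2 := by
    simp_rw [ha, distributionClass_empiricalDistribution]
    exact hy
  have hmono : ∀ ρ : Measure X, ρ ≤ Q → ∫ x, ((a x : ℝ) - b x) ^ 2 ∂ρ ≤ (η / 2) ^ 2 := fun ρ hρ =>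
    (integral_mono_measure hρ (Eventually.of_forall fun x => sq_nonneg _) hi2).trans hy'
  constructor
  · have h1 := hmono _ hPQ
    rw [integral_map measurable_fst.aemeasurable (hdm.pow_const 2).aestronglyMeasurable] at h1
    have hi3 : Integrable (fun z : Sample X => ((a z.1 : ℝ) - b z.1) ^ 2) P :=
      integrable_of_measurable_of_abs_le (c := 1) ((hdm.comp measurable_fst).pow_const 2)
        fun x => by
          rw [abs_pow]
          exact pow_le_one₀ (abs_nonneg _) (hd1 x.1)
    have e : expLoss P a - expLoss P b = ∫ z, (loss a z - loss b z) ∂P :=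
      (integral_sub (integrable_loss ham P) (integrable_loss hbm P)).symm
    rw [e]
    refine abs_integral_le_integral_abs.trans ?_
    -- The estimate 2|s| ≤ (2/η) s² + η/2 passes from mean square to absolute differences; both
    -- terms integrate to at most η/2.
    have h2 : ∫ z, |loss a z - loss b z| ∂P ≤
        ∫ z, (2 / η * ((a z.1 : ℝ) - b z.1) ^ 2 + η / 2) ∂P := by
      refine integral_mono ((integrable_loss ham P).sub (integrable_loss hbm P)).abs
        ((hi3.const_mul _).add (integrable_const _)) fun z => ?_
      refine (abs_loss_sub_le a b z).trans ?_
      rw [← sq_abs ((a z.1 : ℝ) - b z.1), ← sub_nonneg]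
      have : 2 / η * |(a z.1 : ℝ) - b z.1| ^ 2 + η / 2 - 2 * |(a z.1 : ℝ) - b z.1| =
          2 / η * (|(a z.1 : ℝ) - b z.1| - η / 2) ^ 2 := by
        field_simp
        ring
      rw [this]
      positivity
    rw [integral_add (hi3.const_mul _) (integrable_const _), integral_const_mul] at h2
    simp only [integral_const, probReal_univ, one_smul] at h2
    have h3 : 2 / η * ∫ z : Sample X, ((a z.1 : ℝ) - b z.1) ^ 2 ∂P ≤ 2 / η * (η / 2) ^ 2 :=
      mul_le_mul_of_nonneg_left h1 (by positivity)
    have h4 : 2 / η * (η / 2) ^ 2 = η / 2 := by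
      field_simp
    linarith
  · intro k
    have h1 := hmono _ (hzQ k)
    rw [integral_dirac' _ _ (hdm.pow_const 2).stronglyMeasurable] at h1
    have h2 := abs_le_of_sq_le_sq h1 (by positivity)
    linarith [abs_loss_sub_le a b (z k)]

/-- Half of the error is spent on replacing the mixture by a finite average, half on moving the
parameters of that average into `D`. Finite sequences in a countable set are countably many. -/
theorem lossDense_distributionClass {X Y : Type*} [MeasurableSpace X] {H : HypClass X Y}
    (hH : IsJointlyMeasurable H) {D : Set Y}
    (hD : ∀ y, ∃ u : ℕ → Y, (∀ k, u k ∈ D) ∧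
      ∀ x, Tendsto (fun k => H x (u k)) atTop (𝓝 (H x y))) :
    LossDense (distributionClass H)
      fun j : Σ m : ℕ, (Fin (m + 1) → D) => empiricalDistribution H fun k => (j.2 k : Y) := by
  intro P hP n z ν η hη
  obtain ⟨m, y, hy1, hy2⟩ := hH.exists_empiricalDistribution_close ν P z (half_pos hη)
  choose u huD hu using hD
  obtain ⟨l, hl1, hl2⟩ := exists_loss_close_of_tendsto
    (u := fun l x => distributionClass H x (empiricalDistribution H fun k => u (y k) l))
    (h := fun x => distributionClass H x (empiricalDistribution H y))
    (fun l => hH.measurable_distributionClass _)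
    (fun x => by
      rw [tendsto_subtype_rng]
      simp_rw [distributionClass_empiricalDistribution]
      exact (tendsto_finsetSum _ fun k _ =>
        (continuous_subtype_val.tendsto _).comp (hu (y k) x)).div_const _) P z (half_pos hη)
  refine ⟨⟨m, fun k => ⟨u (y k) l, huD _ _⟩⟩, ?_, fun k => ?_⟩
  · exact (abs_sub_le _ _ _).trans ((add_le_add hl1 hy1).trans (add_halves η).le)
  · exact (abs_sub_le _ _ _).trans ((add_le_add (hl2 k) (hy2 k)).trans (add_halves η).le)

/-! ## The sample sizes -/

theorem two_mul_sq_mul_exp_neg_le {M t δ : ℝ} (hM : 0 < M) (hδ : 0 < δ)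
    (h : Real.log 2 + 2 * Real.log M + Real.log (1 / δ) ≤ t) : 2 * M ^ 2 * Real.exp (-t) ≤ δ := by
  have h1 : Real.log (2 * M ^ 2) = Real.log 2 + 2 * Real.log M := by
    rw [Real.log_mul two_ne_zero (by positivity), Real.log_pow]
    norm_num
  rw [one_div, Real.log_inv] at h
  rw [← Real.exp_log (show 0 < 2 * M ^ 2 by positivity), ← Real.exp_add, h1]
  calc _ ≤ Real.exp (Real.log δ) := Real.exp_le_exp.2 (by linarith)
    _ = δ := Real.exp_log hδ

theorem log_le_two_mul_sqrt {x : ℝ} (hx : 0 < x) : Real.log x ≤ 2 * √x := by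
  have h := Real.log_le_self (Real.sqrt_nonneg x)
  rw [Real.log_sqrt hx.le] at h
  linarith

/-- For large `x`, the square of a logarithm that occurs in the bound for the fat-shattering
dimension is small compared to `x`. -/
theorem log_sq_le {x q u : ℝ} (hx : 432000 ^ 2 ≤ x) (hu0 : 0 ≤ u)
    (hq : 432000 * q ^ 2 ≤ x) (hu : u ≤ 8 + Real.log x + 4 * q) : u ^ 2 ≤ x / 3000 := by
  have hx0 : 0 < x := by linarith
  have hs0 := Real.sqrt_nonneg x
  have hs : 432000 ≤ √x := Real.le_sqrt_of_sq_le hx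
  have hss : √x ^ 2 = x := Real.sq_sqrt hx0.le
  set t := √(√x) with ht
  have hts : t ^ 2 = √x := Real.sq_sqrt hs0
  have hlog : Real.log x ≤ 4 * t := by
    have h := log_le_two_mul_sqrt (x := √x) (by linarith)
    rw [Real.log_sqrt hx0.le] at h
    linarith
  have h1 : u ^ 2 ≤ (8 + 4 * t + 4 * q) ^ 2 := pow_le_pow_left₀ hu0 (by linarith) 2
  -- Since 432000 = 48 · 9000, each of the three resulting terms is at most x/9000.
  have h2 : (8 + 4 * t + 4 * q) ^ 2 ≤ 3 * (64 + 16 * t ^ 2 + 16 * q ^ 2) := by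
    nlinarith [sq_nonneg (8 - 4 * t), sq_nonneg (8 - 4 * q), sq_nonneg (4 * t - 4 * q)]
  have h3 : 432000 * √x ≤ x := by nlinarith
  rw [hts] at h2
  linarith

/-- The cardinality of the covers for the fat-shattering dimension is small compared to the sample
size. -/
theorem log_fat_cover_le {d n L : ℕ} {ε : ℝ} (hd : 1 ≤ d) (hn : 1 ≤ n) (hε : 0 < ε) (hε1 : ε < 1)
    (hL : (L : ℝ) ≤ 25 / ε + 1) (hL1 : 1 ≤ L) (hx : 432000 ^ 2 ≤ n * ε ^ 2 / d)
    (hq : 432000 * Real.log (d / ε) ^ 2 ≤ n * ε ^ 2 / d) :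
    Real.log 2 + 2 * Real.log ((2 * ((n + n) * L ^ 2)) ^ (d * (Nat.log 2 ((n + n) * L + 1) + 1)) : ℕ)
      ≤ n * ε ^ 2 / 600 := by
  have hd0 : (1 : ℝ) ≤ d := by exact_mod_cast hd
  have hn0 : (1 : ℝ) ≤ n := by exact_mod_cast hn
  have hL0 : (1 : ℝ) ≤ L := by exact_mod_cast hL1
  have hLe : L * ε ≤ 26 := by
    calc L * ε ≤ (25 / ε + 1) * ε := by gcongr
      _ = 25 + ε := by field_simp
      _ ≤ 26 := by linarith
  have hεsq : ε ^ 2 ≤ 1 := pow_le_one₀ hε.le hε1.le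
  -- 2704 = 4 · 26², and `L * ε ≤ 26`, so `v` dominates the base of the cover bound; it also
  -- dominates the argument of its binary logarithm.
  set v : ℝ := 2704 * n / ε ^ 2 with hv
  have hv1 : 2704 ≤ v := by
    rw [hv, le_div_iff₀ (by positivity)]
    nlinarith
  have hv0 : 0 < v := by linarith
  set u := Real.log v with hu
  have hu2 : 2 ≤ u := by
    rw [hu, Real.le_log_iff_exp_le hv0]
    have h1 : Real.exp 2 = Real.exp 1 ^ 2 := by rw [← Real.exp_nat_mul]; norm_num
    have h2 := Real.exp_one_lt_d9
    have h3 := Real.exp_pos 1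
    rw [h1]
    nlinarith
  have hA : Real.log ((2 * ((n + n) * L ^ 2) : ℕ) : ℝ) ≤ u := by
    refine Real.log_le_log (by push_cast; positivity) ?_
    rw [hv, le_div_iff₀ (by positivity)]
    push_cast
    have : (L * ε) ^ 2 ≤ 26 ^ 2 := pow_le_pow_left₀ (by positivity) hLe 2
    nlinarith
  have hB : ((Nat.log 2 ((n + n) * L + 1) + 1 : ℕ) : ℝ) ≤ 2 * u := by
    have h1 : ((((n + n) * L + 1 : ℕ)) : ℝ) ≤ v := by
      rw [hv, le_div_iff₀ (by positivity)]
      push_cast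
      have h2 : (n : ℝ) * (L * ε) * ε ≤ n * 26 * 1 := by gcongr
      have h3 : (0 : ℝ) < n * L := by positivity
      nlinarith
    have h2 := Real.natLog_le_logb ((n + n) * L + 1) 2
    have h3 : Real.logb (2 : ℕ) ((((n + n) * L + 1 : ℕ)) : ℝ) ≤ 3 / 2 * u := by
      rw [Real.logb, div_le_iff₀ (Real.log_pos (by norm_num))]
      have h4 : Real.log ((((n + n) * L + 1 : ℕ)) : ℝ) ≤ u :=
        Real.log_le_log (by positivity) h1
      have h5 := Real.log_two_gt_d9
      push_cast at h4 ⊢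
      nlinarith
    have h6 := h2.trans h3
    rw [Nat.cast_add, Nat.cast_one]
    linarith
  have hlogM : Real.log ((2 * ((n + n) * L ^ 2)) ^ (d * (Nat.log 2 ((n + n) * L + 1) + 1)) : ℕ) ≤
      2 * d * u ^ 2 := by
    rw [Nat.cast_pow, Real.log_pow, Nat.cast_mul]
    calc _ ≤ d * (2 * u) * u := by gcongr
      _ = _ := by ring
  have hu_sq : u ^ 2 ≤ (n * ε ^ 2 / d) / 3000 := by
    refine log_sq_le hx (by linarith) hq ?_
    have hdε : 0 < (d : ℝ) / ε := by positivity
    have hx0 : (0 : ℝ) < n * ε ^ 2 / d := by positivity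
    -- This expresses log n through x = nε²/d and log(d/ε), the two quantities controlled by the
    -- hypotheses.
    have h1 : v ≤ 2704 * (n * ε ^ 2 / d) * (d / ε) ^ 4 := by
      rw [hv, div_le_iff₀ (by positivity)]
      have : 2704 * (n * ε ^ 2 / d) * (d / ε) ^ 4 * ε ^ 2 = 2704 * (n : ℝ) * d ^ 3 := by
        field_simp
      rw [this]
      exact le_mul_of_one_le_right (by positivity) (one_le_pow₀ hd0)
    have h2 := Real.log_le_log hv0 h1
    rw [Real.log_mul (by positivity) (by positivity), Real.log_mul (by norm_num) hx0.ne',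
      Real.log_pow] at h2
    have h3 : Real.log 2704 ≤ 8 := by
      have h5 := Real.exp_one_gt_d9
      rw [Real.log_le_iff_le_exp (by norm_num)]
      have h4 : Real.exp 8 = Real.exp 1 ^ 8 := by rw [← Real.exp_nat_mul]; norm_num
      rw [h4]
      calc (2704 : ℝ) ≤ 2.7182818283 ^ 8 := by norm_num
        _ ≤ _ := pow_le_pow_left₀ (by norm_num) h5.le 8
    push_cast at h2
    linarith
  have h1 : d * u ^ 2 ≤ n * ε ^ 2 / 3000 := by
    calc d * u ^ 2 ≤ d * ((n * ε ^ 2 / d) / 3000) := by gcongr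
      _ = n * ε ^ 2 / 3000 := by field_simp
  -- Thus log 2 is absorbed as well, and the total is at most 5du² ≤ nε²/600.
  have h2 : 1 ≤ d * u ^ 2 := by nlinarith
  linarith [Real.log_two_lt_d9]

/-- The cardinality of the covers for the VC-dimension is small compared to the sample size. -/
theorem log_vc_cover_le {d n : ℕ} {ε : ℝ} (hd : 1 ≤ d) (hn : 1 ≤ n) (hε : 0 < ε)
    (hx : 7200 ^ 2 ≤ n * ε ^ 2 / d) (hq : 7200 * Real.log (d / ε) ≤ n * ε ^ 2 / d) :
    Real.log 2 + 2 * Real.log ((n + n + 1) ^ d : ℕ) ≤ n * ε ^ 2 / 600 := by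
  have hd0 : (1 : ℝ) ≤ d := by exact_mod_cast hd
  have hn0 : (1 : ℝ) ≤ n := by exact_mod_cast hn
  set x : ℝ := n * ε ^ 2 / d with hxd
  have hx0 : 0 < x := by linarith
  have hdε : 0 < (d : ℝ) / ε := by positivity
  have h1 : ((n + n + 1 : ℕ) : ℝ) ≤ 3 * x * (d / ε) ^ 2 := by
    have : 3 * x * (d / ε) ^ 2 = 3 * (n : ℝ) * d := by
      rw [hxd]
      field_simp
    rw [this]
    push_cast
    nlinarith
  have h2 := Real.log_le_log (by positivity) h1
  rw [Real.log_mul (by positivity) (by positivity), Real.log_mul (by norm_num) hx0.ne',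
    Real.log_pow] at h2
  have h3 : Real.log 3 ≤ 2 := by
    have := Real.log_le_sub_one_of_pos (show (0 : ℝ) < 3 by norm_num)
    linarith
  have h4 := log_le_two_mul_sqrt hx0
  have h5 : 7200 * √x ≤ x := by
    have hs : 7200 ≤ √x := Real.le_sqrt_of_sq_le hx
    nlinarith [Real.sq_sqrt hx0.le]
  rw [Nat.cast_pow, Real.log_pow]
  push_cast at h2 ⊢
  -- The left side is at most 5 + 4√x + 4 log(d/ε), and each term is at most x/1800.
  have h6 : 1 + 2 * Real.log ((n : ℝ) + n + 1) ≤ x / 600 := by linarith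
  have h7 : d * (1 + 2 * Real.log ((n : ℝ) + n + 1)) ≤ d * (x / 600) := by gcongr
  have h8 : d * (x / 600) = n * ε ^ 2 / 600 := by
    rw [hxd]
    field_simp
  linarith [Real.log_two_lt_d9]

/-- A constant `C` for which the two sample sizes suffice for classes of positive
dimension. -/
def IsSampleSizeConstant (ε₀ C : ℝ) : Prop :=
  ∀ (d : ℕ) (ε δ : ℝ), 1 ≤ d → 0 < ε → ε ≤ ε₀ → 0 < δ → δ < 1 →
    (1 ≤ fatBound C d ε δ ∧ ∀ n ≥ fatBound C d ε δ, ∀ L : ℕ, 1 ≤ L → (L : ℝ) ≤ 25 / ε + 1 →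
      2 * (((2 * ((n + n) * L ^ 2)) ^ (d * (Nat.log 2 ((n + n) * L + 1) + 1)) : ℕ) : ℝ) ^ 2 *
        Real.exp (-(n * ε ^ 2 / 300)) ≤ δ) ∧
    (1 ≤ vcBound C d ε δ ∧ ∀ n ≥ vcBound C d ε δ,
      2 * (((n + n + 1) ^ d : ℕ) : ℝ) ^ 2 * Real.exp (-(n * ε ^ 2 / 300)) ≤ δ)

/-- Since ε₀ < 1, log(d/ε) is at least c = log(1/ε₀) > 0 for d ≥ 1. The powers of 1/c in `C` let the
terms with factor d absorb absolute constants. Half of the exponent nε²/300 pays for the covers,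
half for log(1/δ). -/
theorem exists_isSampleSizeConstant {ε₀ : ℝ} (hε₀ : ε₀ < 1) :
    ∃ C : ℝ, 0 < C ∧ IsSampleSizeConstant ε₀ C := by
  rcases le_or_gt ε₀ 0 with h0 | h0
  · exact ⟨1, one_pos, fun d ε δ _ h1 h2 => absurd (h1.trans_le h2) (not_lt.2 h0)⟩
  set c := Real.log (1 / ε₀) with hc
  have hc0 : 0 < c := Real.log_pos (by rw [lt_div_iff₀ h0]; linarith)
  set A : ℝ := 432000 ^ 2 with hA
  have hA0 : 0 < A := by norm_num [hA]
  set C := A * (1 + 1 / c + 1 / c ^ 2) with hC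
  have hC0 : 0 < C := by positivity
  have hCA : A ≤ C := by
    have : (0 : ℝ) < 1 / c + 1 / c ^ 2 := by positivity
    exact le_mul_of_one_le_right hA0.le (by linarith)
  have hCc : A ≤ C * c := by
    have : C * c = A * (c + 1 + 1 / c) := by rw [hC]; field_simp
    have h2 : (0 : ℝ) < 1 / c := by positivity
    rw [this]
    exact le_mul_of_one_le_right hA0.le (by linarith)
  have hCc2 : A ≤ C * c ^ 2 := by
    have : C * c ^ 2 = A * (c ^ 2 + c + 1) := by rw [hC]; field_simp
    rw [this]
    exact le_mul_of_one_le_right hA0.le (by nlinarith)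
  refine ⟨C, hC0, fun d ε δ hd hε hεε hδ hδ1 => ?_⟩
  have hd0 : (1 : ℝ) ≤ d := by exact_mod_cast hd
  have hε1 : ε < 1 := by linarith
  have hεsq : ε ^ 2 ≤ 1 := pow_le_one₀ hε.le hε1.le
  set q := Real.log (d / ε) with hq
  have hcq : c ≤ q := by
    refine Real.log_le_log (by positivity) ?_
    exact div_le_div₀ (by linarith) hd0 hε hεε
  have hq0 : 0 < q := hc0.trans_le hcq
  have hl0 : 0 < Real.log (1 / δ) := Real.log_pos (by rw [lt_div_iff₀ hδ]; linarith)
  constructor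
  · constructor
    · exact Nat.one_le_iff_ne_zero.2 (Nat.ceil_pos.2 (by positivity)).ne'
    intro n hn L hL1 hL
    have hn' : C * (d / ε ^ 4 * q ^ 2 + 1 / ε ^ 2 * Real.log (1 / δ)) ≤ n := Nat.ceil_le.1 hn
    have hn1 : 1 ≤ n := by
      have : (0 : ℝ) < n := lt_of_lt_of_le (by positivity) hn'
      exact_mod_cast this
    -- From the term d/ε⁴ only its lower bound d/ε² is needed below.
    have hn2 : C * (d * q ^ 2) + C * Real.log (1 / δ) ≤ n * ε ^ 2 := by
      have h1 : C * (d * q ^ 2 / ε ^ 2) + C * Real.log (1 / δ) ≤ n * ε ^ 2 := by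
        calc _ = C * (d / ε ^ 4 * q ^ 2 + 1 / ε ^ 2 * Real.log (1 / δ)) * ε ^ 2 := by
              field_simp
          _ ≤ _ := by gcongr
      have h2 : d * q ^ 2 ≤ d * q ^ 2 / ε ^ 2 := by
        rw [le_div_iff₀ (by positivity)]
        exact mul_le_of_le_one_right (by positivity) hεsq
      have h3 := mul_le_mul_of_nonneg_left h2 hC0.le
      linarith
    have hxq : C * q ^ 2 ≤ n * ε ^ 2 / d := by
      rw [le_div_iff₀ (by linarith)]
      calc C * q ^ 2 * d = C * (d * q ^ 2) := by ring
        _ ≤ _ := by linarith [mul_pos hC0 hl0]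
    have hqc : c ^ 2 ≤ q ^ 2 := pow_le_pow_left₀ hc0.le hcq 2
    have hx : A ≤ n * ε ^ 2 / d :=
      hCc2.trans ((mul_le_mul_of_nonneg_left hqc hC0.le).trans hxq)
    have hAq : 432000 * q ^ 2 ≤ n * ε ^ 2 / d := by
      have : 432000 ≤ A := by norm_num [hA]
      exact (mul_le_mul_of_nonneg_right (this.trans hCA) (sq_nonneg q)).trans hxq
    refine two_mul_sq_mul_exp_neg_le ?_ hδ ?_
    · have : 0 < 2 * ((n + n) * L ^ 2) := by positivity
      exact_mod_cast Nat.pow_pos this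
    · have h1 := log_fat_cover_le hd hn1 hε hε1 hL hL1 hx hAq
      have h2 : 600 * Real.log (1 / δ) ≤ n * ε ^ 2 := by
        have : 600 ≤ A := by norm_num [hA]
        have h3 : 0 ≤ C * (d * q ^ 2) := by positivity
        have h4 := mul_le_mul_of_nonneg_right (this.trans hCA) hl0.le
        linarith
      linarith
  · constructor
    · exact Nat.one_le_iff_ne_zero.2 (Nat.ceil_pos.2 (by positivity)).ne'
    intro n hn
    have hn' : C * (1 / ε ^ 2 * (d * q + Real.log (1 / δ))) ≤ n := Nat.ceil_le.1 hn
    have hn1 : 1 ≤ n := by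
      have : (0 : ℝ) < n := lt_of_lt_of_le (by positivity) hn'
      exact_mod_cast this
    have hn2 : C * (d * q) + C * Real.log (1 / δ) ≤ n * ε ^ 2 := by
      calc _ = C * (1 / ε ^ 2 * (d * q + Real.log (1 / δ))) * ε ^ 2 := by field_simp
        _ ≤ _ := by gcongr
    have hxq : C * q ≤ n * ε ^ 2 / d := by
      rw [le_div_iff₀ (by linarith)]
      calc C * q * d = C * (d * q) := by ring
        _ ≤ _ := by linarith [mul_pos hC0 hl0]
    have hx : 7200 ^ 2 ≤ n * ε ^ 2 / d := by
      have : 7200 ^ 2 ≤ A := by norm_num [hA]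
      exact this.trans (hCc.trans ((mul_le_mul_of_nonneg_left hcq hC0.le).trans hxq))
    have hAq : 7200 * q ≤ n * ε ^ 2 / d := by
      have : 7200 ≤ A := by norm_num [hA]
      exact (mul_le_mul_of_nonneg_right (this.trans hCA) hq0.le).trans hxq
    refine two_mul_sq_mul_exp_neg_le (by positivity) hδ ?_
    have h1 := log_vc_cover_le hd hn1 hε hx hAq
    have h2 : 600 * Real.log (1 / δ) ≤ n * ε ^ 2 := by
      have : 600 ≤ A := by norm_num [hA]
      have h3 : 0 ≤ C * (d * q) := by positivity
      have h4 := mul_le_mul_of_nonneg_right (this.trans hCA) hl0.le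
      linarith
    linarith

/-! ## Learnability of the statistical classes -/

theorem HasCover.mono {X Y ι : Type*} {H : HypClass X Y} {x : ι → X} {α β : ℝ} {M : ℕ}
    (h : HasCover H x α M) (hαβ : α ≤ β) : HasCover H x β M :=
  let ⟨T, hT, hc, hy⟩ := h
  ⟨T, hT, hc, fun y => let ⟨c, hcT, hk⟩ := hy y; ⟨c, hcT, fun k => (hk k).trans hαβ⟩⟩

theorem hasCover_sum_of_fatDim_le {X Y : Type*} {H : HypClass X Y} {ε : ℝ} (hε : 0 < ε) {d : ℕ}
    (hd1 : 1 ≤ d) (hd : fatDim H (ε / 50) ≤ d) {n : ℕ} (hn : 1 ≤ n) (x : Fin n ⊕ Fin n → X) :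
    HasCover H x (4 * (ε / 50)) ((2 * ((n + n) * (⌊25 / ε⌋₊ + 1) ^ 2)) ^
      (d * (Nat.log 2 ((n + n) * (⌊25 / ε⌋₊ + 1) + 1) + 1))) := by
  have : Nonempty (Fin n ⊕ Fin n) := ⟨.inl ⟨0, hn⟩⟩
  have hL : 1 / (2 * (ε / 50)) < (⌊25 / ε⌋₊ + 1 : ℕ) := by
    have h : 1 / (2 * (ε / 50)) = 25 / ε := by
      field_simp
      norm_num
    rw [h]
    exact_mod_cast Nat.lt_floor_add_one (25 / ε)
  simpa using hasCover_of_fatDim_le (by positivity) hL hd1 hd x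

theorem hasCover_sum_of_vcDim_le {X Y : Type*} {H : HypClass X Y} {ε : ℝ} (hε : 0 < ε) {d : ℕ}
    (hH : IsConceptClass H) (hd : vcDim H ≤ d) {n : ℕ} (x : Fin n ⊕ Fin n → X) :
    HasCover H x (4 * (ε / 50)) ((n + n + 1) ^ d) := by
  simpa using (hasCover_of_vcDim_le hH hd x).mono (show 0 ≤ 4 * (ε / 50) by positivity)

theorem integrable_coe_unitInterval {Ω : Type*} [MeasurableSpace Ω] {μ : Measure Ω}
    [IsProbabilityMeasure μ] {f : Ω → unitInterval} (hf : Measurable f) :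
    Integrable (fun ω => (f ω : ℝ)) μ :=
  integrable_of_measurable_of_abs_le (c := 1) (measurable_subtype_coe.comp hf) fun ω => by
    rw [abs_of_nonneg (f ω).2.1]
    exact (f ω).2.2

theorem expectation_le_add {Ω : Type*} [MeasurableSpace Ω] {μ : Measure Ω}
    [IsProbabilityMeasure μ] {f g : Ω → unitInterval} (hf : Measurable f) (hg : Measurable g)
    {c : ℝ} (h : ∀ ω, (f ω : ℝ) - g ω ≤ c) :
    (expectation μ f : ℝ) - expectation μ g ≤ c := by
  have h1 : ∫ ω, ((f ω : ℝ) - g ω) ∂μ ≤ ∫ _ω, c ∂μ :=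
    integral_mono ((integrable_coe_unitInterval hf).sub (integrable_coe_unitInterval hg))
      (integrable_const _) h
  rw [integral_sub (integrable_coe_unitInterval hf) (integrable_coe_unitInterval hg)] at h1
  simpa using! h1

/-- An expectation is within `c` of every number that is within `c` of all values. -/
theorem abs_expectation_sub_le {Ω : Type*} [MeasurableSpace Ω] {μ : Measure Ω}
    [IsProbabilityMeasure μ] {f : Ω → unitInterval} (hf : Measurable f) (a : unitInterval) {c : ℝ}
    (h : ∀ ω, |(f ω : ℝ) - a| ≤ c) : |(expectation μ f : ℝ) - a| ≤ c := by
  have ha : (expectation μ (fun _ => a) : ℝ) = a := by simp [expectation]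
  have h1 := expectation_le_add (μ := μ) hf measurable_const fun ω => (abs_le.1 (h ω)).2
  have h2 := expectation_le_add (μ := μ) (f := fun _ => a) measurable_const hf (c := c) fun ω => by
    linarith [(abs_le.1 (h ω)).1]
  rw [ha] at h1 h2
  exact abs_le.2 ⟨by linarith, h1⟩

/-! ### The expectation class -/

section ExpectationClass

variable {Ω X Y : Type*} [MeasurableSpace Ω] [MeasurableSpace X] [Nonempty Y] {μ : Measure Ω}
  [IsProbabilityMeasure μ] {F : Ω → HypClass X Y}

theorem agnosticPACLearnable_expectationClass_of_hasCover (hF : IsMeasurableFamily F)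
    (hmeas : ∀ y, Measurable fun x => expectationClass μ F x y)
    (hsep : IsSeparableClass (expectationClass μ F)) {ε δ : ℝ} (hε : 0 < ε) {N : ℕ} (hN : 1 ≤ N)
    {M : ℕ → ℕ}
    (hcov : ∀ n ≥ N, ∀ ω, ∀ x : Fin n ⊕ Fin n → X, HasCover (F ω) x (4 * (ε / 50)) (M n))
    (hM : ∀ n ≥ N, 2 * (M n : ℝ) ^ 2 * Real.exp (-(n * ε ^ 2 / 300)) ≤ δ) :
    AgnosticPACLearnable (expectationClass μ F) ε δ N := by
  obtain ⟨D, hDc, hD⟩ := hsep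
  have : Countable D := hDc
  exact agnosticPACLearnable_of_card (fun j : D => hmeas j) (lossDense_of_forall_tendsto hmeas hD)
    hε hN (fun n hn r => symBound_expectationClass hF fun ω ω' =>
      symBound_residualProd (hcov n hn ω) (hcov n hn ω') r) hM

theorem agnosticPACLearnable_expectationClass_of_fatDim_le_zero (hF : IsMeasurableFamily F)
    (hmeas : ∀ y, Measurable fun x => expectationClass μ F x y) {ε : ℝ} (hε : 0 < ε)
    (hd : ∀ ω, fatDim (F ω) (ε / 50) ≤ 0) (δ : ℝ) (N : ℕ) :
    AgnosticPACLearnable (expectationClass μ F) ε δ N := by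
  refine agnosticPACLearnable_of_abs_sub_le hmeas δ (fun x y y' => ?_) N
  have h := fun y y' => expectation_le_add (μ := μ) (hF x y) (hF x y') fun ω =>
    sub_le_of_fatDim_le_zero (hd ω) x y y'
  have h1 := h y y'
  have h2 := h y' y
  simp only [expectationClass]
  exact abs_le.2 ⟨by linarith, by linarith⟩

end ExpectationClass

/-! ### The distribution class -/

section DistributionClass

variable {X Y : Type*} [MeasurableSpace X] [Nonempty Y] {H : HypClass X Y}

instance : Nonempty (CompatDistribution H) :=
  ⟨empiricalDistribution H (fun _ : Fin (0 + 1) => Classical.arbitrary Y)⟩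

theorem agnosticPACLearnable_distributionClass_of_hasCover (hH : IsJointlyMeasurable H)
    (hsep : IsSeparableClass H) {ε δ : ℝ} (hε : 0 < ε) {N : ℕ} (hN : 1 ≤ N) {M : ℕ → ℕ}
    (hcov : ∀ n ≥ N, ∀ x : Fin n ⊕ Fin n → X, HasCover H x (4 * (ε / 50)) (M n))
    (hM : ∀ n ≥ N, 2 * (M n : ℝ) ^ 2 * Real.exp (-(n * ε ^ 2 / 300)) ≤ δ) :
    AgnosticPACLearnable (distributionClass H) ε δ N := by
  obtain ⟨D, hDc, hD⟩ := hsep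
  have : Countable D := hDc
  exact agnosticPACLearnable_of_card (fun j => hH.measurable_distributionClass _)
    (lossDense_distributionClass hH hD) hε hN (fun n hn r => symBound_distributionClass
      (symBound_residualProd (hcov n hn) (hcov n hn) r)) hM

theorem agnosticPACLearnable_distributionClass_of_fatDim_le_zero (hH : IsJointlyMeasurable H)
    {ε : ℝ} (hε : 0 < ε) (hd : fatDim H (ε / 50) ≤ 0) (δ : ℝ) (N : ℕ) :
    AgnosticPACLearnable (distributionClass H) ε δ N := by
  refine agnosticPACLearnable_of_abs_sub_le hH.measurable_distributionClass δ
    (fun x ν ν' => ?_) N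
  -- The two distributions may live on different σ-algebras, so each is compared with one fixed
  -- hypothesis; the sum 4ε/50 is below ε/2.
  have h : ∀ ν, |(distributionClass H x ν : ℝ) - H x (Classical.arbitrary Y)| ≤ 2 * (ε / 50) := by
    intro ν
    let _ := ν.sigma
    have := ν.isProb
    refine abs_expectation_sub_le (μ := ν.law) (ν.measurable x) _ fun y => ?_
    have h1 := sub_le_of_fatDim_le_zero hd x y (Classical.arbitrary Y)
    have h2 := sub_le_of_fatDim_le_zero hd x (Classical.arbitrary Y) y
    exact abs_le.2 ⟨by linarith, h1⟩
  have h1 := abs_le.1 (h ν)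
  have h2 := abs_le.1 (h ν')
  exact abs_le.2 ⟨by linarith [h1.1, h2.2], by linarith [h1.2, h2.1]⟩

end DistributionClass

theorem floor_add_one_le {ε : ℝ} (hε : 0 < ε) : ((⌊25 / ε⌋₊ + 1 : ℕ) : ℝ) ≤ 25 / ε + 1 := by
  have := Nat.floor_le (show 0 ≤ 25 / ε by positivity)
  push_cast
  linarith

theorem IsSampleSizeConstant.learnable_expectationClass {ε₀ C : ℝ} (hC : IsSampleSizeConstant ε₀ C)
    {Ω X Y : Type*} [MeasurableSpace Ω] [MeasurableSpace X] [Nonempty Y] (μ : Measure Ω)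
    [IsProbabilityMeasure μ] (F : Ω → HypClass X Y) (hF : IsMeasurableFamily F)
    (hmeas : ∀ y, Measurable fun x => expectationClass μ F x y)
    (hsep : IsSeparableClass (expectationClass μ F)) (d : ℕ) (ε δ : ℝ) (hε : 0 < ε) (hε₀ : ε ≤ ε₀)
    (hδ : 0 < δ) (hδ1 : δ < 1) :
    ((∀ ω, fatDim (F ω) (ε / 50) ≤ d) →
      AgnosticPACLearnable (expectationClass μ F) ε δ (fatBound C d ε δ)) ∧
    ((∀ ω, IsConceptClass (F ω) ∧ vcDim (F ω) ≤ d) →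
      AgnosticPACLearnable (expectationClass μ F) ε δ (vcBound C d ε δ)) := by
  -- For d = 0 the sample size has no term that absorbs log 2 as δ tends to 1. But then all
  -- hypotheses are uniformly close, and any fixed output succeeds.
  rcases Nat.eq_zero_or_pos d with rfl | hd1
  · rw [Nat.cast_zero]
    exact ⟨fun h => agnosticPACLearnable_expectationClass_of_fatDim_le_zero hF hmeas hε h δ _,
      fun h => agnosticPACLearnable_expectationClass_of_fatDim_le_zero hF hmeas hε
        (fun ω => (fatDim_le_vcDim (h ω).1 (by positivity)).trans (h ω).2) δ _⟩
  · obtain ⟨⟨hN₁, h₁⟩, hN₂, h₂⟩ := hC d ε δ hd1 hε hε₀ hδ hδ1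
    exact ⟨fun h => agnosticPACLearnable_expectationClass_of_hasCover hF hmeas hsep hε hN₁
        (fun n hn ω x => hasCover_sum_of_fatDim_le hε hd1 (h ω) (hN₁.trans hn) x)
        fun n hn => h₁ n hn _ (Nat.le_add_left _ _) (floor_add_one_le hε),
      fun h => agnosticPACLearnable_expectationClass_of_hasCover hF hmeas hsep hε hN₂
        (fun n _ ω x => hasCover_sum_of_vcDim_le hε (h ω).1 (h ω).2 x) h₂⟩

theorem IsSampleSizeConstant.learnable_distributionClass {ε₀ C : ℝ} (hC : IsSampleSizeConstant ε₀ C)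
    {X Y : Type*} [MeasurableSpace X] [Nonempty Y] (H : HypClass X Y) (hH : IsJointlyMeasurable H)
    (hsep : IsSeparableClass H) (d : ℕ) (ε δ : ℝ) (hε : 0 < ε) (hε₀ : ε ≤ ε₀) (hδ : 0 < δ)
    (hδ1 : δ < 1) :
    (fatDim H (ε / 50) ≤ d →
      AgnosticPACLearnable (distributionClass H) ε δ (fatBound C d ε δ)) ∧
    (IsConceptClass H → vcDim H ≤ d →
      AgnosticPACLearnable (distributionClass H) ε δ (vcBound C d ε δ)) := by
  rcases Nat.eq_zero_or_pos d with rfl | hd1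
  · rw [Nat.cast_zero]
    exact ⟨fun h => agnosticPACLearnable_distributionClass_of_fatDim_le_zero hH hε h δ _,
      fun h h' => agnosticPACLearnable_distributionClass_of_fatDim_le_zero hH hε
        ((fatDim_le_vcDim h (by positivity)).trans h') δ _⟩
  · obtain ⟨⟨hN₁, h₁⟩, hN₂, h₂⟩ := hC d ε δ hd1 hε hε₀ hδ hδ1
    exact ⟨fun h => agnosticPACLearnable_distributionClass_of_hasCover hH hsep hε hN₁
        (fun n hn x => hasCover_sum_of_fatDim_le hε hd1 h (hN₁.trans hn) x)
        fun n hn => h₁ n hn _ (Nat.le_add_left _ _) (floor_add_one_le hε),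
      fun h h' => agnosticPACLearnable_distributionClass_of_hasCover hH hsep hε hN₂
        (fun n _ x => hasCover_sum_of_vcDim_le hε h h' x) h₂⟩

end StatLearning

theorem mainTheorem1 (ε₀ : ℝ) (hε₀ : ε₀ < 1) :
    ∃ C : ℝ, 0 < C ∧
      -- the expectation class of a measurable family
      (∀ (Ω : Type*) (X : Type*) (Y : Type*) [MeasurableSpace Ω] [MeasurableSpace X]
        [Nonempty Y] (μ : Measure Ω) [IsProbabilityMeasure μ] (F : Ω → HypClass X Y),
        IsMeasurableFamily F →
        (∀ y, Measurable fun x => expectationClass μ F x y) →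
        IsSeparableClass (expectationClass μ F) →
        ∀ (d : ℕ) (ε δ : ℝ), 0 < ε → ε ≤ ε₀ → 0 < δ → δ < 1 →
          ((∀ ω, fatDim (F ω) (ε / 50) ≤ d) →
            AgnosticPACLearnable (expectationClass μ F) ε δ (fatBound C d ε δ)) ∧
          ((∀ ω, IsConceptClass (F ω) ∧ vcDim (F ω) ≤ d) →
            AgnosticPACLearnable (expectationClass μ F) ε δ (vcBound C d ε δ))) ∧
      -- the distribution class
      (∀ (X : Type*) (Y : Type*) [MeasurableSpace X] [Nonempty Y] (H : HypClass X Y),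
        IsJointlyMeasurable H → IsSeparableClass H →
        ∀ (d : ℕ) (ε δ : ℝ), 0 < ε → ε ≤ ε₀ → 0 < δ → δ < 1 →
          (fatDim H (ε / 50) ≤ d →
            AgnosticPACLearnable (distributionClass H) ε δ (fatBound C d ε δ)) ∧
          (IsConceptClass H → vcDim H ≤ d →
            AgnosticPACLearnable (distributionClass H) ε δ (vcBound C d ε δ))) ∧
      -- the dual distribution class, in terms of the dimension of the dual class
      (∀ (X : Type*) (Y : Type*) [MeasurableSpace Y] [Nonempty X] (H : HypClass X Y),
        IsJointlyMeasurable (dualClass H) → IsSeparableClass (dualClass H) →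
        ∀ (d : ℕ) (ε δ : ℝ), 0 < ε → ε ≤ ε₀ → 0 < δ → δ < 1 →
          (fatDim (dualClass H) (ε / 50) ≤ d →
            AgnosticPACLearnable (dualDistributionClass H) ε δ (fatBound C d ε δ)) ∧
          (IsConceptClass H → vcDim (dualClass H) ≤ d →
            AgnosticPACLearnable (dualDistributionClass H) ε δ (vcBound C d ε δ))) := by
  obtain ⟨C, hC0, hC⟩ := exists_isSampleSizeConstant hε₀
  refine ⟨C, hC0, ?_, ?_, ?_⟩
  · intro Ω X Y _ _ _ μ _ F hF hmeas hsep d ε δ hε hεε₀ hδ hδ1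
    exact hC.learnable_expectationClass μ F hF hmeas hsep d ε δ hε hεε₀ hδ hδ1
  · intro X Y _ _ H hH hsep d ε δ hε hεε₀ hδ hδ1
    exact hC.learnable_distributionClass H hH hsep d ε δ hε hεε₀ hδ hδ1
  · intro X Y _ _ H hH hsep d ε δ hε hεε₀ hδ hδ1
    obtain ⟨h₁, h₂⟩ := hC.learnable_distributionClass (dualClass H) hH hsep d ε δ hε hεε₀ hδ hδ1
    exact ⟨h₁, fun h => h₂ fun y x => h x y⟩
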